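/- **Setting.** Let $\zeta=-1$ (fermions) or $\zeta=+1$ (bosons) and let $\mathcal V$ be the space of finite linear combinations of occupation number states $|n_1,\dots,n_d\rangle$ ($n_i\in\{0,1\}$ for fermions, $n_i\in\{0,1,2,\dots\}$ for bosons), which are declared orthonormal. The Fock space is the completion of $\mathcal V$. Let $a_i,a_i^\dagger:\mathcal V\to\mathcal V$ be the usual annihilation and creation operators, $\hat N=\sum_i a_i^\dagger a_i$, and let the $N$-particle subspace be the (finite-dimensional) $N$-eigenspace of $\hat N$. For an operator $A$ on $\mathcal V$ put $\mathrm{Tr}\,A=\sum_{\mathbf n}\langle\mathbf n|A|\mathbf n\rangle$. Let $\gamma:[s_0,s_1]\to\mathbb C$, $s_0<s_1$, parametrize a piecewise smooth contour (continuous, differentiable with nonzero derivative off a finite set, with $\dot\gamma$ piecewise continuous); write $I=(s_0,s_1)$, $\dot z(s)=\dot\gamma(s)$. For each contour time $s$ let $\hat H(s)=\sum_{i,j}h_{ij}(s)\,a_i^\dagger a_j+\hat U(s)$ be particle-number-conserving, with $h(s)\in\mathbb C^{d\times d}$ and $\hat U(s)$ a polynomial in the $a_i,a_i^\dagger$ with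 $1\le i\le p$ only (an impurity Hamiltonian with fragment $1,\dots,p$). For a Hamiltonian given on the contour itself, $\hat H(s)$ means $\hat H(\gamma(s))$. Assume that the restriction of $\hat H(s)$ to each $N$-particle subspace is piecewise continuous on $[s_0,s_1]$. Let $U(s,s')$, $s,s'\in[s_0,s_1]$, be the solution of $$\partial_sU(s,s')=-i\,\dot z(s)\,\hat H(s)\,U(s,s'),\qquad U(s',s')=\mathrm{Id},$$ (matrix elements continuous in $s$, equation off finitely many $s$), and put $Z=\mathrm{Tr}\,U(s_1,s_0)$ and $$G_{ij}(s,s')=\frac{-i}{Z}\begin{cases}\mathrm{Tr}\big[U(s_1,s)\,a_i\,U(s,s')\,a_j^\dagger\,U(s',s_0)\big],& s'<s,\\ \zeta\,\mathrm{Tr}\big[U(s_1,s')\,a_j^\dagger\,U(s',s)\,a_i\,U(s,s_0)\big],& s'\ge s.\end{cases}$$ **Assumptions.** $Z\ne0$ and, in the bosonic case: (a) $U(s,s')$ is bounded for all $s_0\le s'<s\le s_1$, and for some such pair the operator norm of its restriction to the $N$-particle subspace decays exponentially in $N$; (b) $G$ is well defined as a locally integrable kernel: for all $i,j$, with $A_{ij}(s,s')$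 the operator under the trace, $\sum_{\mathbf n}|\langle\mathbf n|A_{ij}(s,s')|\mathbf n\rangle|$ is integrable over every compact subset of $I\times I$. **Distributions.** On $I\times I$ define $$[\Sigma G](s,s')=i\,\dot z(s)^{-1}\partial_sG(s,s')-h(s)G(s,s')-I_d\,\dot z(s)^{-1}\delta(s-s'),$$ $$[G\Sigma](s,s')=-i\,\dot z(s')^{-1}\partial_{s'}G(s,s')-G(s,s')h(s')-I_d\,\dot z(s')^{-1}\delta(s-s'),$$ in the sense of distributions: the first is paired with test functions $\varphi\in C_c^\infty(I\times I)$ by integration against $\dot z(s)\,ds\,ds'$, the second by integration against $\dot z(s')\,ds\,ds'$, so that $$\langle[\Sigma G]_{ij},\varphi\rangle=-i\iint G_{ij}\,\partial_s\varphi\,ds\,ds'-\iint\dot z(s)\,[h(s)G(s,s')]_{ij}\,\varphi\,ds\,ds'-\delta_{ij}\int\varphi(s,s)\,ds,$$ $$\langle[G\Sigma]_{ij},\varphi\rangle=i\iint G_{ij}\,\partial_{s'}\varphi\,ds\,ds'-\iint\dot z(s')\,[G(s,s')h(s')]_{ij}\,\varphi\,ds\,ds'-\delta_{ij}\int\varphi(s,s)\,ds.$$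 **Theorem.** The kernels $G_{ij}$ (all $i,j$), $\dot z(s)[h(s)G(s,s')]_{ij}$ ($i>p$) and $\dot z(s')[G(s,s')h(s')]_{ij}$ ($j>p$) are locally integrable on $I\times I$, and $$[\Sigma G]_{ij}=0\ \text{ for } i>p,\qquad [G\Sigma]_{ij}=0\ \text{ for } j>p .$$ In particular, for $p=0$, the Green's function satisfies, for all entries and in the same sense of distributions, $i\partial_zG-h(z)G=I_d\,\delta(z,z')$ and $-i\partial_{z'}G-G\,h(z')=I_d\,\delta(z,z')$, where $\partial_z=\dot z(s)^{-1}\partial_s$ and $\delta(z,z')=\dot z(s)^{-1}\delta(s-s')$. -/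

import Mathlib

open Set Filter Topology MeasureTheory
open scoped ContDiff

noncomputable section

/-! ## Second quantization with finitely many states -/

/-- Particle statistics. -/
inductive Statistics where
  | fermion
  | boson

/-- The sign `ζ`: `-1` for fermions and `+1` for bosons. -/
def Statistics.zeta : Statistics → ℂ
  | .fermion => -1
  | .boson => 1

/-- Occupation numbers `n = (n_1, …, n_d)`: natural numbers, which are `0` or `1` for fermions. -/
abbrev Occ (σ : Statistics) (d : ℕ) : Type :=
  {n : Fin d → ℕ // σ = Statistics.fermion → ∀ i, n i ≤ 1}

/-- The space `𝒱_{ζ,d}` of finite formal linear combinations of occupation number states.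
It is a dense subspace of the Fock space `ℱ_{ζ,d}` (all of it for fermions), and it is the common
domain of the operators below. -/
abbrev FockV (σ : Statistics) (d : ℕ) : Type := Occ σ d →₀ ℂ

/-- Linear operators on `𝒱_{ζ,d}`. -/
abbrev FockOp (σ : Statistics) (d : ℕ) : Type := Module.End ℂ (FockV σ d)

variable {σ : Statistics} {d : ℕ}

/-- The basis vector `|n⟩`. -/
def ket (n : Occ σ d) : FockV σ d := Finsupp.single n 1

/-- The matrix element `⟨m| A |n⟩` in the occupation number basis. -/
def matElem (m : Occ σ d) (A : FockOp σ d) (n : Occ σ d) : ℂ := A (ket n) m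

/-- The norm of a vector of `𝒱_{ζ,d}`, for which the occupation number basis is orthonormal. -/
def fockNorm (φ : FockV σ d) : ℝ := Real.sqrt (∑ n ∈ φ.support, ‖φ n‖ ^ 2)

/-- The sign `ζ ^ (∑_{j < i} n_j)`. -/
def jwSign (n : Occ σ d) (i : Fin d) : ℂ := σ.zeta ^ (∑ j ∈ Finset.Iio i, n.1 j)

/-- `n` with one particle less in the state `i`. -/
def Occ.lower (n : Occ σ d) (i : Fin d) : Occ σ d :=
  ⟨Function.update n.1 i (n.1 i - 1), by
    intro h j
    by_cases hj : j = i
    · subst hj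
      have := n.2 h j
      simp only [Function.update_self]
      omega
    · simpa [Function.update_of_ne hj] using n.2 h j⟩

/-- `n` with one particle more in the state `i`, if the statistics allow it. -/
def Occ.raise (n : Occ σ d) (i : Fin d) (hi : ¬ (σ = Statistics.fermion ∧ n.1 i = 1)) :
    Occ σ d :=
  ⟨Function.update n.1 i (n.1 i + 1), by
    intro h j
    by_cases hj : j = i
    · subst hj
      have := n.2 h j
      have h1 : n.1 j ≠ 1 := fun h1 => hi ⟨h, h1⟩
      simp only [Function.update_self]
      omega
    · simpa [Function.update_of_ne hj] using n.2 h j⟩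

open Classical in
/-- The annihilation operator `a_i`. -/
def annih (i : Fin d) : FockOp σ d :=
  Finsupp.linearCombination ℂ fun n : Occ σ d =>
    if n.1 i = 0 then 0
    else (jwSign n i * (Real.sqrt (n.1 i : ℝ) : ℂ)) • ket (n.lower i)

open Classical in
/-- The creation operator `a_i†`. -/
def creat (i : Fin d) : FockOp σ d :=
  Finsupp.linearCombination ℂ fun n : Occ σ d =>
    if hi : σ = Statistics.fermion ∧ n.1 i = 1 then 0
    else (jwSign n i * (Real.sqrt ((n.1 i : ℝ) + 1) : ℂ)) • ket (n.raise i hi)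

/-- The single-particle operator `a† h a = ∑ h_ij a_i† a_j`. -/
def oneBody (h : Matrix (Fin d) (Fin d) ℂ) : FockOp σ d :=
  ∑ i, ∑ j, h i j • (creat i * annih j)

/-- The total number operator `N̂ = ∑ a_i† a_i`. -/
def numberOp : FockOp σ d := ∑ i, creat i * annih i

/-- The `N`-particle subspace: the `N`-eigenspace of `N̂`. -/
def nParticle (σ : Statistics) (d N : ℕ) : Submodule ℂ (FockV σ d) :=
  Module.End.eigenspace (numberOp : FockOp σ d) (N : ℂ)

/-- `A` maps every `N`-particle subspace to itself. -/
def ConservesNumber (A : FockOp σ d) : Prop :=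
  ∀ N : ℕ, ∀ φ ∈ nParticle σ d N, A φ ∈ nParticle σ d N

/-- `A` is bounded, that is, it extends to a bounded operator on the Fock space. -/
def IsBoundedOp (A : FockOp σ d) : Prop :=
  ∃ C : ℝ, ∀ φ, fockNorm (A φ) ≤ C * fockNorm φ

/-- The operator norm of the restriction of `A` to the `N`-particle subspace decays exponentially
in `N`. -/
def DecaysExponentially (A : FockOp σ d) : Prop :=
  ∃ C c : ℝ, 0 < c ∧ ∀ N : ℕ, ∀ φ ∈ nParticle σ d N,
    fockNorm (A φ) ≤ C * Real.exp (-c * N) * fockNorm φ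

/-- The Fock space trace `∑_n ⟨n| A |n⟩`. -/
def fockTrace (A : FockOp σ d) : ℂ := ∑' n, matElem n A n

/-- The operators that are polynomials of `a_i†, a_i` for `i = 1, …, p` (with indices in `Fin d`
counted from `0`: for `i < p`). -/
def fragmentAlgebra (σ : Statistics) (d p : ℕ) : Subalgebra ℂ (FockOp σ d) :=
  Algebra.adjoin ℂ {A | ∃ i : Fin d, (i : ℕ) < p ∧ (A = annih i ∨ A = creat i)}

/-! ## Contours and Hamiltonians on them -/

/-- `f` is piecewise continuous on `[a, b]`: it is continuous off a finite set and has one-sided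
limits everywhere. -/
def PiecewiseContinuousOn (f : ℝ → ℂ) (a b : ℝ) : Prop :=
  (∃ P : Finset ℝ, ∀ s ∈ Icc a b, s ∉ P → ContinuousWithinAt f (Icc a b) s) ∧
  ∀ s ∈ Icc a b, (∃ l, Tendsto f (𝓝[Icc a b ∩ Iio s] s) (𝓝 l)) ∧
    ∃ r, Tendsto f (𝓝[Icc a b ∩ Ioi s] s) (𝓝 r)

/-- `γ` parametrizes a piecewise smooth contour: it is continuous, and off finitely many parameters
it is differentiable with nonzero derivative; the derivative is piecewise continuous.
(Only one derivative is asked for.) -/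
def IsPiecewiseSmoothContour (γ : ℝ → ℂ) (s₀ s₁ : ℝ) : Prop :=
  ContinuousOn γ (Icc s₀ s₁) ∧
  (∃ P : Finset ℝ, ∀ s ∈ Ioo s₀ s₁, s ∉ P → DifferentiableAt ℝ γ s ∧ deriv γ s ≠ 0) ∧
  PiecewiseContinuousOn (deriv γ) s₀ s₁

/-- `H(s)` is a particle-number-conserving impurity Hamiltonian `a† h(s) a + Û(s)` for all contour
times `s`, with the fragment `1, …, p`. -/
def IsImpurityHamiltonian (p : ℕ) (h : ℝ → Matrix (Fin d) (Fin d) ℂ) (H : ℝ → FockOp σ d)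
    (s₀ s₁ : ℝ) : Prop :=
  ∀ s ∈ Ioo s₀ s₁, ConservesNumber (H s) ∧
    ∃ W ∈ fragmentAlgebra σ d p, H s = oneBody (h s) + W

/-- The restrictions of `H(s)` to the (finite-dimensional) particle subspaces are, individually,
piecewise continuous in `s`. -/
def IsPiecewiseContinuousOp (H : ℝ → FockOp σ d) (s₀ s₁ : ℝ) : Prop :=
  ∀ m n : Occ σ d, PiecewiseContinuousOn (fun s => matElem m (H s) n) s₀ s₁

/-- `U` is the evolution operator of `H` along `γ`: the solution of
`∂_s U(s, s') = -i ż(s) H(s) U(s, s')`, `U(s', s') = Id`, for `s, s'` in `[s₀, s₁]`.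
A solution is continuous, and satisfies the equation off finitely many `s` (for every matrix
element, since `ż` and `H` are only piecewise continuous). As `H` acts on each of the
finite-dimensional particle subspaces separately, the solution exists and is unique. -/
def IsEvolution (γ : ℝ → ℂ) (H : ℝ → FockOp σ d) (s₀ s₁ : ℝ)
    (U : ℝ → ℝ → FockOp σ d) : Prop :=
  ∀ s' ∈ Icc s₀ s₁, U s' s' = 1 ∧
    ∀ m n : Occ σ d, ContinuousOn (fun s => matElem m (U s s') n) (Icc s₀ s₁) ∧
      ∃ P : Finset ℝ, ∀ s ∈ Ioo s₀ s₁, s ∉ P →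
        HasDerivAt (fun r => matElem m (U r s') n)
          (-Complex.I * deriv γ s * matElem m (H s * U s s') n) s

/-- The trace-class assumption: forward evolution is bounded, and for some pair of times its
restriction to the `N`-particle subspace decays exponentially in `N`. -/
def TraceClassAssumption (U : ℝ → ℝ → FockOp σ d) (s₀ s₁ : ℝ) : Prop :=
  (∀ s ∈ Icc s₀ s₁, ∀ s' ∈ Icc s₀ s₁, s' < s → IsBoundedOp (U s s')) ∧
  ∃ s ∈ Icc s₀ s₁, ∃ s' ∈ Icc s₀ s₁, s' < s ∧ DecaysExponentially (U s s')

/-! ## The contour-ordered Green's function -/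

/-- The partition function `Z = Tr U(s₁, s₀)`. -/
def partitionFn (U : ℝ → ℝ → FockOp σ d) (s₀ s₁ : ℝ) : ℂ := fockTrace (U s₁ s₀)

/-- The operator under the trace in the Green's function, that is, `a_i` and `a_j†` inserted into
`U(s₁, s₀)` at the contour times `s` and `s'` in contour order. -/
def greenOp (U : ℝ → ℝ → FockOp σ d) (s₀ s₁ : ℝ) (i j : Fin d) (s s' : ℝ) : FockOp σ d :=
  if s' < s then U s₁ s * annih i * U s s' * creat j * U s' s₀
  else σ.zeta • (U s₁ s' * creat j * U s' s * annih i * U s s₀)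

/-- The contour-ordered Green's function `G_ij(s, s')`. -/
def green (U : ℝ → ℝ → FockOp σ d) (s₀ s₁ : ℝ) (i j : Fin d) (s s' : ℝ) : ℂ :=
  -Complex.I / partitionFn U s₀ s₁ * fockTrace (greenOp U s₀ s₁ i j s s')

/-- The traces in the definition of `G` exist, as a locally integrable kernel on `I × I`,
`I = (s₀, s₁)`: the absolute series `∑_n |⟨n| … |n⟩|` is locally integrable in `(s, s')`. -/
def HasLocallyIntegrableTraces (U : ℝ → ℝ → FockOp σ d) (s₀ s₁ : ℝ) : Prop :=
  ∀ i j : Fin d, ∀ K : Set (ℝ × ℝ), IsCompact K → K ⊆ Ioo s₀ s₁ ×ˢ Ioo s₀ s₁ →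
    ∫⁻ x in K, ∑' n, ‖matElem n (greenOp U s₀ s₁ i j x.1 x.2) n‖ₑ < ⊤

/-! ## Distributions on the contour -/

/-- Test functions on `I × I`, `I = (s₀, s₁)`. -/
def IsTestFunction (s₀ s₁ : ℝ) (φ : ℝ × ℝ → ℂ) : Prop :=
  ContDiff ℝ ∞ φ ∧ HasCompactSupport φ ∧ tsupport φ ⊆ Ioo s₀ s₁ ×ˢ Ioo s₀ s₁

/-- The kernel `ż(s) (h(s) G(s, s'))_ij`. -/
def hGKernel (γ : ℝ → ℂ) (h : ℝ → Matrix (Fin d) (Fin d) ℂ) (U : ℝ → ℝ → FockOp σ d)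
    (s₀ s₁ : ℝ) (i j : Fin d) (x : ℝ × ℝ) : ℂ :=
  deriv γ x.1 * ∑ l, h x.1 i l * green U s₀ s₁ l j x.1 x.2

/-- The kernel `ż(s') (G(s, s') h(s'))_ij`. -/
def GhKernel (γ : ℝ → ℂ) (h : ℝ → Matrix (Fin d) (Fin d) ℂ) (U : ℝ → ℝ → FockOp σ d)
    (s₀ s₁ : ℝ) (i j : Fin d) (x : ℝ × ℝ) : ℂ :=
  deriv γ x.2 * ∑ l, green U s₀ s₁ i l x.1 x.2 * h x.2 l j

/-- The distribution `(i ∂_z G - h G)_ij`, where `∂_z = ż(s)⁻¹ ∂_s`. A kernel `A` on the contour is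
paired with a test function as `∫∫ A(s, s') φ(s, s') dz(s) ds'`, where `dz(s) = ż(s) ds`; so the
factor `ż(s)⁻¹`, which is undefined at finitely many points, cancels, and
`∫∫ (i ż(s)⁻¹ ∂_s G) φ dz(s) ds' = -i ∫∫ G ∂_s φ ds ds'` by definition of `∂_s G`. -/
def leftMotion (γ : ℝ → ℂ) (h : ℝ → Matrix (Fin d) (Fin d) ℂ) (U : ℝ → ℝ → FockOp σ d)
    (s₀ s₁ : ℝ) (i j : Fin d) (φ : ℝ × ℝ → ℂ) : ℂ :=
  -Complex.I * (∫ x in Ioo s₀ s₁ ×ˢ Ioo s₀ s₁,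
      green U s₀ s₁ i j x.1 x.2 * fderiv ℝ φ x (1, 0)) -
    ∫ x in Ioo s₀ s₁ ×ˢ Ioo s₀ s₁, hGKernel γ h U s₀ s₁ i j x * φ x

/-- The distribution `(-i ∂_{z'} G - G h)_ij`, where `∂_{z'} = ż(s')⁻¹ ∂_{s'}`, with the pairing
`∫∫ A(s, s') φ(s, s') ds dz(s')`. -/
def rightMotion (γ : ℝ → ℂ) (h : ℝ → Matrix (Fin d) (Fin d) ℂ) (U : ℝ → ℝ → FockOp σ d)
    (s₀ s₁ : ℝ) (i j : Fin d) (φ : ℝ × ℝ → ℂ) : ℂ :=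
  Complex.I * (∫ x in Ioo s₀ s₁ ×ˢ Ioo s₀ s₁,
      green U s₀ s₁ i j x.1 x.2 * fderiv ℝ φ x (0, 1)) -
    ∫ x in Ioo s₀ s₁ ×ˢ Ioo s₀ s₁, GhKernel γ h U s₀ s₁ i j x * φ x

/-- The distribution `δ(z, z') = ż(s)⁻¹ δ(s - s')`. In either of the two pairings it is
`φ ↦ ∫ φ(s, s) ds`. -/
def contourDelta (s₀ s₁ : ℝ) (φ : ℝ × ℝ → ℂ) : ℂ := ∫ s in Ioo s₀ s₁, φ (s, s)

/-- The distribution `[ΣG]_ij = (i ∂_z G - h G - I_d δ)_ij`. -/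
def sigmaG (γ : ℝ → ℂ) (h : ℝ → Matrix (Fin d) (Fin d) ℂ) (U : ℝ → ℝ → FockOp σ d)
    (s₀ s₁ : ℝ) (i j : Fin d) (φ : ℝ × ℝ → ℂ) : ℂ :=
  leftMotion γ h U s₀ s₁ i j φ - (1 : Matrix (Fin d) (Fin d) ℂ) i j * contourDelta s₀ s₁ φ

/-- The distribution `[GΣ]_ij = (-i ∂_{z'} G - G h - I_d δ)_ij`. -/
def gSigma (γ : ℝ → ℂ) (h : ℝ → Matrix (Fin d) (Fin d) ℂ) (U : ℝ → ℝ → FockOp σ d)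
    (s₀ s₁ : ℝ) (i j : Fin d) (φ : ℝ × ℝ → ℂ) : ℂ :=
  rightMotion γ h U s₀ s₁ i j φ - (1 : Matrix (Fin d) (Fin d) ℂ) i j * contourDelta s₀ s₁ φ

end

/-!
# Equations of motion of contour Green's functions outside of an impurity

Fix an occupation number state `n`. The diagonal matrix element `⟨n| ⋯ |n⟩` of the operator under
the trace in `G_ij(s, s')` only involves states with at most one particle more than `n`, so it is an
entry of a product of finite matrices. With `T(s)` the matrix of `U(s, s₀)` it equals
`⟨n| T(s₁) ã_i(s) ã_j†(s') |n⟩` for `s' < s` and `ζ ⟨n| T(s₁) ã_j†(s') ã_i(s) |n⟩` otherwise, where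
`ã = T⁻¹ a T` are Heisenberg operators (`greaterTerm_eq`, `lesserTerm_eq`). This uses that `U`
conserves the particle number and has the group property; both follow from uniqueness for linear
differential equations with bounded coefficients and finitely many exceptional points
(`eq_zero_of_linear_ode`).

If `i` is outside of the fragment, then `[a_i, H] = ∑_l h_il a_l`. Indeed `a_i` commutes up to signs
`ζ` with the generators of the fragment, so it commutes with every even polynomial in them, and the
interaction is even because it conserves the particle number (`mul_eq_parity_conj_mul`,
`annih_mul_hamiltonian`). So Heisenberg's equation reads `∂_s ã_i = -i ż ∑_l h_il ã_l`
(`hasDerivAt_annihH`). By the canonical (anti)commutation relations the matrix element jumps by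
`δ_ij ⟨n| U(s₁, s₀) |n⟩` across the diagonal `s = s'`. The fundamental theorem of calculus on both
sides of the diagonal and Fubini's theorem turn this into a distributional equation for each `n`
(`integral_mul_fderiv_fst`), and the jumps sum up to `δ_ij Z`.

It remains to sum over `n`. The absolute series of the traces is locally integrable: by assumption
for bosons, and because there are only finitely many states for fermions. The coefficients `h_il`
with `i` outside of the fragment are bounded and measurable, being matrix elements of `H` between
states with at most one particle (`hopping_eq_matElem`). So integration against a test function can
be done term by term (`hasSum_setIntegral_mul`). The second time argument is treated in the same
way, starting from `[H, a_j†] = ∑_l h_lj a_l†`.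
-/

variable {σ : Statistics} {d : ℕ}

/-! ### Canonical (anti)commutation relations -/

namespace Statistics

lemma zeta_sq (σ : Statistics) : σ.zeta * σ.zeta = 1 := by
  cases σ <;> simp [zeta]

end Statistics

lemma FockOp.ext_ket {A B : FockOp σ d} (h : ∀ n, A (ket n) = B (ket n)) : A = B := by
  refine Finsupp.lhom_ext' fun n => LinearMap.ext_ring ?_
  simpa [ket] using h n

open Classical in
/-- The state `|n⟩` for an arbitrary `n : Fin d → ℕ`; it is zero if the statistics do not allow
`n`. -/
noncomputable def ketOf (σ : Statistics) (n : Fin d → ℕ) : FockV σ d :=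
  if h : σ = Statistics.fermion → ∀ i, n i ≤ 1 then ket ⟨n, h⟩ else 0

/-- The sign `ζ ^ (∑_{j < i} n_j)` for an arbitrary `n : Fin d → ℕ`. -/
noncomputable def signOf (σ : Statistics) (n : Fin d → ℕ) (i : Fin d) : ℂ :=
  σ.zeta ^ (∑ j ∈ Finset.Iio i, n j)

lemma ketOf_val (n : Occ σ d) : ketOf σ n.1 = ket n := dif_pos n.2

lemma ketOf_of_not {n : Fin d → ℕ} (h : ¬ (σ = Statistics.fermion → ∀ i, n i ≤ 1)) :
    ketOf σ n = 0 := dif_neg h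

lemma annih_ket (i : Fin d) (n : Occ σ d) :
    annih i (ket n) = (signOf σ n.1 i * (Real.sqrt (n.1 i : ℝ) : ℂ)) •
      ketOf σ (Function.update n.1 i (n.1 i - 1)) := by
  have : ketOf σ (Function.update n.1 i (n.1 i - 1)) = ket (n.lower i) :=
    ketOf_val (n.lower i)
  rw [this, annih, ket, Finsupp.linearCombination_single, one_smul]
  split_ifs with h
  · simp [h]
  · rfl

/-- This holds for all `n`: if `n` is not allowed, then neither is `n + e_i`. -/
lemma creat_ketOf (i : Fin d) (n : Fin d → ℕ) :
    creat i (ketOf σ n) = (signOf σ n i * (Real.sqrt ((n i : ℝ) + 1) : ℂ)) •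
      ketOf σ (Function.update n i (n i + 1)) := by
  by_cases hn : σ = Statistics.fermion → ∀ i, n i ≤ 1
  · rw [show ketOf σ n = ket ⟨n, hn⟩ from dif_pos hn, creat, ket,
      Finsupp.linearCombination_single, one_smul]
    split_ifs with h
    · rw [ketOf_of_not, smul_zero]
      intro h'
      have := h' h.1 i
      have h2 : n i = 1 := h.2
      simp [h2] at this
    · exact congrArg _ (ketOf_val (Occ.raise ⟨n, hn⟩ i h)).symm
  · rw [ketOf_of_not hn, ketOf_of_not, map_zero, smul_zero]
    contrapose hn
    intro h j
    have := hn h j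
    by_cases hj : j = i
    · subst hj
      rw [Function.update_self] at this
      omega
    · rwa [Function.update_of_ne hj] at this

lemma annih_ketOf (i : Fin d) {n : Fin d → ℕ} (hn : σ = Statistics.fermion → ∀ i, n i ≤ 1) :
    annih i (ketOf σ n) = (signOf σ n i * (Real.sqrt (n i : ℝ) : ℂ)) •
      ketOf σ (Function.update n i (n i - 1)) := by
  rw [show ketOf σ n = ket ⟨n, hn⟩ from dif_pos hn, annih_ket]

lemma signOf_update_of_le {n : Fin d → ℕ} {i k : Fin d} (h : k ≤ i) (a : ℕ) :
    signOf σ (Function.update n i a) k = signOf σ n k := by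
  unfold signOf
  congr 1
  refine Finset.sum_congr rfl fun j hj => ?_
  rw [Function.update_of_ne]
  exact ((Finset.mem_Iio.1 hj).trans_le h).ne

lemma signOf_update_succ {n : Fin d → ℕ} {i k : Fin d} (h : i < k) :
    signOf σ (Function.update n i (n i + 1)) k = σ.zeta * signOf σ n k := by
  unfold signOf
  rw [← pow_succ']
  congr 1
  rw [← Finset.add_sum_erase _ _ (Finset.mem_Iio.2 h),
    ← Finset.add_sum_erase _ n (Finset.mem_Iio.2 h), Function.update_self]
  rw [Finset.sum_congr rfl fun j hj => Function.update_of_ne (Finset.mem_erase.1 hj).1 _ _]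
  ring

lemma signOf_update_pred {n : Fin d → ℕ} {i k : Fin d} (h : i < k) (hn : n i ≠ 0) :
    signOf σ (Function.update n i (n i - 1)) k = σ.zeta * signOf σ n k := by
  have h1 := signOf_update_succ (σ := σ) (n := Function.update n i (n i - 1)) h
  rw [Function.update_self, Function.update_idem, Nat.sub_add_cancel (Nat.pos_of_ne_zero hn),
    Function.update_eq_self] at h1
  rw [h1, ← mul_assoc, σ.zeta_sq, one_mul]

lemma signOf_mul_self (n : Fin d → ℕ) (i : Fin d) : signOf σ n i * signOf σ n i = 1 := by
  rw [signOf, ← mul_pow, σ.zeta_sq, one_pow]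

lemma Occ.lower_allowed {n : Fin d → ℕ} (hn : σ = Statistics.fermion → ∀ i, n i ≤ 1)
    (i : Fin d) : σ = Statistics.fermion → ∀ j, Function.update n i (n i - 1) j ≤ 1 :=
  (Occ.lower ⟨n, hn⟩ i).2

theorem creat_mul_creat (i k : Fin d) :
    (creat i * creat k : FockOp σ d) = σ.zeta • (creat k * creat i) := by
  -- for `i ≠ k`, moving a particle past the other one changes exactly one of the two signs
  have key : ∀ {i k : Fin d}, i < k →
      (creat i * creat k : FockOp σ d) = σ.zeta • (creat k * creat i) := by
    intro i k hik
    refine FockOp.ext_ket fun n => ?_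
    rw [← ketOf_val]
    simp only [Module.End.mul_apply, LinearMap.smul_apply, creat_ketOf, map_smul, smul_smul]
    rw [Function.update_of_ne hik.ne, Function.update_of_ne hik.ne', signOf_update_of_le hik.le,
      signOf_update_succ hik, Function.update_comm hik.ne]
    congr 1
    linear_combination (-(signOf σ n.1 k * signOf σ n.1 i * (Real.sqrt ((n.1 k : ℝ) + 1) : ℂ) *
      (Real.sqrt ((n.1 i : ℝ) + 1) : ℂ))) * σ.zeta_sq
  rcases lt_trichotomy i k with h | rfl | h
  · exact key h
  · cases σ
    · have : (creat i * creat i : FockOp .fermion d) = 0 := by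
        refine FockOp.ext_ket fun n => ?_
        rw [← ketOf_val]
        simp only [Module.End.mul_apply, creat_ketOf, map_smul, smul_smul, LinearMap.zero_apply]
        rw [ketOf_of_not, smul_zero]
        intro h
        simpa using h rfl i
      rw [this, smul_zero]
    · simp [Statistics.zeta]
  · rw [key h, smul_smul, σ.zeta_sq, one_smul]

/-- In particular `a_i² = 0` for fermions, where `ζ = -1`. -/
theorem annih_mul_annih (i k : Fin d) :
    (annih i * annih k : FockOp σ d) = σ.zeta • (annih k * annih i) := by
  have key : ∀ {i k : Fin d}, i < k →
      (annih i * annih k : FockOp σ d) = σ.zeta • (annih k * annih i) := by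
    intro i k hik
    refine FockOp.ext_ket fun n => ?_
    rw [← ketOf_val]
    simp only [Module.End.mul_apply, LinearMap.smul_apply, annih_ketOf _ n.2,
      annih_ketOf _ (Occ.lower_allowed n.2 _), map_smul, smul_smul]
    rw [Function.update_of_ne hik.ne, Function.update_of_ne hik.ne', signOf_update_of_le hik.le,
      Function.update_comm hik.ne]
    by_cases h0 : n.1 i = 0
    · simp [h0]
    rw [signOf_update_pred hik h0]
    congr 1
    linear_combination (-(signOf σ n.1 k * signOf σ n.1 i * (Real.sqrt (n.1 k : ℝ) : ℂ) *
      (Real.sqrt (n.1 i : ℝ) : ℂ))) * σ.zeta_sq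
  rcases lt_trichotomy i k with h | rfl | h
  · exact key h
  · cases σ
    · have : (annih i * annih i : FockOp .fermion d) = 0 := by
        refine FockOp.ext_ket fun n => ?_
        rw [← ketOf_val]
        simp only [Module.End.mul_apply, annih_ketOf _ n.2,
          annih_ketOf _ (Occ.lower_allowed n.2 _), map_smul, smul_smul, LinearMap.zero_apply]
        have h1 : n.1 i - 1 = 0 := Nat.sub_eq_zero_of_le (n.2 rfl i)
        simp [h1]
      rw [this, smul_zero]
    · simp [Statistics.zeta]
  · rw [key h, smul_smul, σ.zeta_sq, one_smul]

lemma annih_mul_creat_of_ne {i k : Fin d} (hik : i ≠ k) :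
    (annih i * creat k : FockOp σ d) = σ.zeta • (creat k * annih i) := by
  refine FockOp.ext_ket fun n => ?_
  rw [← ketOf_val]
  simp only [Module.End.mul_apply, LinearMap.smul_apply, annih_ketOf _ n.2, creat_ketOf, map_smul,
    smul_smul]
  by_cases hv : σ = Statistics.fermion → ∀ j, Function.update n.1 k (n.1 k + 1) j ≤ 1
  · rw [annih_ketOf _ hv, smul_smul, Function.update_of_ne hik, Function.update_of_ne hik.symm,
      Function.update_comm hik]
    by_cases h0 : n.1 i = 0
    · simp [h0]
    congr 1
    rcases lt_or_gt_of_ne hik with h | h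
    · rw [signOf_update_of_le h.le, signOf_update_pred h h0]
      linear_combination (-(signOf σ n.1 k * signOf σ n.1 i * (Real.sqrt ((n.1 k : ℝ) + 1) : ℂ) *
        (Real.sqrt (n.1 i : ℝ) : ℂ))) * σ.zeta_sq
    · rw [signOf_update_of_le h.le, signOf_update_succ h]
      ring
  · rw [ketOf_of_not hv, map_zero, smul_zero, ketOf_of_not, smul_zero]
    contrapose hv
    intro hf j
    by_cases hj : j = k
    · subst hj
      have := hv hf j
      rw [Function.update_self, Function.update_of_ne hik.symm] at this
      rwa [Function.update_self]
    · rw [Function.update_of_ne hj]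
      exact n.2 hf j

lemma creat_mul_annih_ket (i : Fin d) (n : Occ σ d) :
    creat i (annih i (ket n)) = (n.1 i : ℂ) • ket n := by
  rw [annih_ket, map_smul, creat_ketOf, smul_smul, Function.update_self, Function.update_idem,
    signOf_update_of_le le_rfl]
  by_cases h0 : n.1 i = 0
  · simp [h0]
  have h1 : n.1 i - 1 + 1 = n.1 i := Nat.sub_add_cancel (Nat.pos_of_ne_zero h0)
  have h2 : ((n.1 i - 1 : ℕ) : ℝ) + 1 = n.1 i := by exact_mod_cast h1
  rw [h1, h2, Function.update_eq_self, ketOf_val]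
  congr 1
  have h3 : (Real.sqrt (n.1 i : ℝ) : ℂ) * (Real.sqrt (n.1 i : ℝ) : ℂ) = n.1 i := by
    rw [← Complex.ofReal_mul, Real.mul_self_sqrt (Nat.cast_nonneg _)]
    simp
  linear_combination (Real.sqrt (n.1 i : ℝ) : ℂ) * (Real.sqrt (n.1 i : ℝ) : ℂ) *
    signOf_mul_self (σ := σ) n.1 i + h3

lemma annih_mul_creat_self (i : Fin d) :
    (annih i * creat i : FockOp σ d) = σ.zeta • (creat i * annih i) + 1 := by
  refine FockOp.ext_ket fun n => ?_
  simp only [Module.End.mul_apply, LinearMap.add_apply, LinearMap.smul_apply,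
    Module.End.one_apply, creat_mul_annih_ket]
  rw [← ketOf_val, creat_ketOf, map_smul]
  by_cases hv : σ = Statistics.fermion → ∀ j, Function.update n.1 i (n.1 i + 1) j ≤ 1
  · rw [annih_ketOf _ hv, smul_smul, Function.update_self, Function.update_idem,
      Nat.add_sub_cancel, Function.update_eq_self, signOf_update_of_le le_rfl, smul_smul]
    have h3 : (Real.sqrt ((n.1 i : ℝ) + 1) : ℂ) * (Real.sqrt (((n.1 i + 1 : ℕ) : ℝ)) : ℂ)
        = n.1 i + 1 := by
      rw [Nat.cast_succ, ← Complex.ofReal_mul, Real.mul_self_sqrt (by positivity)]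
      simp
    have h4 : (n.1 i : ℂ) = σ.zeta * n.1 i := by
      cases σ
      · have := hv rfl i
        have h0 : n.1 i = 0 := by
          rw [Function.update_self] at this
          omega
        simp [h0]
      · simp [Statistics.zeta]
    rw [← h4, show ∀ (c : ℂ) (v : FockV σ d), c • v + v = (c + 1) • v from fun c v => by
      rw [add_smul, one_smul]]
    congr 1
    linear_combination (Real.sqrt ((n.1 i : ℝ) + 1) : ℂ) * (Real.sqrt (((n.1 i + 1 : ℕ) : ℝ)) : ℂ) *
      signOf_mul_self (σ := σ) n.1 i + h3
  · -- a fermion state that is occupied cannot be occupied twice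
    rw [ketOf_of_not hv, map_zero, smul_zero]
    obtain ⟨hf, h1⟩ : σ = Statistics.fermion ∧ n.1 i = 1 := by
      by_contra hc
      exact hv (n.raise i hc).2
    subst hf
    simp [h1, Statistics.zeta]

theorem annih_mul_creat (i k : Fin d) :
    (annih i * creat k : FockOp σ d) =
      σ.zeta • (creat k * annih i) + (1 : Matrix (Fin d) (Fin d) ℂ) i k • 1 := by
  by_cases h : i = k
  · subst h
    simp [annih_mul_creat_self]
  · simp [annih_mul_creat_of_ne h, Matrix.one_apply_ne h]

/-! ### Particle number -/

/-- The number of particles `∑_i n_i`. -/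
def Occ.total (n : Occ σ d) : ℕ := ∑ i, n.1 i

lemma Occ.total_update (n : Fin d → ℕ) (i : Fin d) (a : ℕ) :
    ∑ j, Function.update n i a j + n i = ∑ j, n j + a := by
  rw [Finset.sum_update_of_mem (Finset.mem_univ i), ← Finset.erase_eq,
    ← Finset.add_sum_erase _ n (Finset.mem_univ i)]
  ring

lemma FockV.induction_ket {P : FockV σ d → Prop} (φ : FockV σ d) (h0 : P 0)
    (hadd : ∀ φ ψ, P φ → P ψ → P (φ + ψ)) (hket : ∀ (c : ℂ) n, P (c • ket n)) : P φ := by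
  induction φ using Finsupp.induction_linear with
  | zero => exact h0
  | add f g hf hg => exact hadd f g hf hg
  | single n c =>
    have := hket c n
    rwa [ket, Finsupp.smul_single, smul_eq_mul, mul_one] at this

lemma numberOp_ket (n : Occ σ d) : numberOp (ket n) = (n.total : ℂ) • ket n := by
  simp only [numberOp, LinearMap.sum_apply, Module.End.mul_apply, creat_mul_annih_ket,
    Occ.total, Nat.cast_sum, Finset.sum_smul]

lemma ket_apply_self (n : Occ σ d) : ket n n = 1 := by simp [ket]

lemma ket_apply_of_ne {m n : Occ σ d} (h : n ≠ m) : ket n m = 0 := by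
  simp [ket, h]

lemma numberOp_apply (φ : FockV σ d) (n : Occ σ d) : numberOp φ n = (n.total : ℂ) * φ n := by
  induction φ using FockV.induction_ket with
  | h0 => simp
  | hadd φ ψ h1 h2 => simp [h1, h2, mul_add]
  | hket c m =>
    rw [map_smul, numberOp_ket]
    by_cases h : m = n
    · subst h
      simp [ket_apply_self, mul_comm]
    · simp [ket_apply_of_ne h]

lemma mem_nParticle {N : ℕ} {φ : FockV σ d} :
    φ ∈ nParticle σ d N ↔ ∀ n, φ n ≠ 0 → n.total = N := by
  rw [nParticle, Module.End.mem_eigenspace_iff, Finsupp.ext_iff]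
  refine forall_congr' fun n => ?_
  rw [numberOp_apply, Finsupp.smul_apply, smul_eq_mul]
  constructor
  · intro h hn
    exact_mod_cast mul_right_cancel₀ hn h
  · intro h
    by_cases hn : φ n = 0
    · simp [hn]
    · rw [h hn]

lemma ket_mem_nParticle (n : Occ σ d) : ket n ∈ nParticle σ d n.total := by
  rw [mem_nParticle]
  intro m hm
  by_contra h
  exact hm (ket_apply_of_ne fun h' => h (h' ▸ rfl))

lemma ConservesNumber.matElem_eq_zero {A : FockOp σ d} (hA : ConservesNumber A) {m n : Occ σ d}
    (h : m.total ≠ n.total) : matElem m A n = 0 := by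
  by_contra h'
  exact h (mem_nParticle.1 (hA _ _ (ket_mem_nParticle n)) m h')

/-! ### The grading by particle parity -/

/-- The operator `ζ ^ N̂`: particle parity for fermions, the identity for bosons. -/
noncomputable def parity (σ : Statistics) (d : ℕ) : FockOp σ d :=
  Finsupp.linearCombination ℂ fun n : Occ σ d => σ.zeta ^ n.total • ket n

lemma parity_ket (n : Occ σ d) : parity σ d (ket n) = σ.zeta ^ n.total • ket n := by
  rw [parity, ket, Finsupp.linearCombination_single, one_smul, ket]

lemma parity_ketOf (n : Fin d → ℕ) :
    parity σ d (ketOf σ n) = σ.zeta ^ (∑ i, n i) • ketOf σ n := by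
  by_cases hn : σ = Statistics.fermion → ∀ i, n i ≤ 1
  · rw [show ketOf σ n = ket ⟨n, hn⟩ from dif_pos hn, parity_ket]
    rfl
  · rw [ketOf_of_not hn, map_zero, smul_zero]

lemma parity_mul_self : parity σ d * parity σ d = 1 := by
  refine FockOp.ext_ket fun n => ?_
  rw [Module.End.mul_apply, parity_ket, map_smul, parity_ket, smul_smul, ← mul_pow, σ.zeta_sq,
    one_pow, one_smul, Module.End.one_apply]

lemma parity_mul_creat (i : Fin d) :
    parity σ d * creat i = σ.zeta • (creat i * parity σ d) := by
  refine FockOp.ext_ket fun n => ?_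
  rw [← ketOf_val]
  simp only [Module.End.mul_apply, LinearMap.smul_apply, creat_ketOf, map_smul, parity_ketOf,
    smul_smul]
  have := Occ.total_update n.1 i (n.1 i + 1)
  rw [show ∑ j, Function.update n.1 i (n.1 i + 1) j = ∑ j, n.1 j + 1 by omega]
  congr 1
  ring

lemma parity_mul_annih (i : Fin d) :
    parity σ d * annih i = σ.zeta • (annih i * parity σ d) := by
  refine FockOp.ext_ket fun n => ?_
  rw [← ketOf_val]
  simp only [Module.End.mul_apply, LinearMap.smul_apply, annih_ketOf _ n.2, map_smul,
    parity_ketOf, smul_smul]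
  by_cases h0 : n.1 i = 0
  · simp [h0]
  have := Occ.total_update n.1 i (n.1 i - 1)
  rw [show ∑ j, n.1 j = ∑ j, Function.update n.1 i (n.1 i - 1) j + 1 by omega]
  congr 1
  rw [pow_succ]
  linear_combination (-(signOf σ n.1 i * (Real.sqrt (n.1 i : ℝ) : ℂ) *
    σ.zeta ^ (∑ j, Function.update n.1 i (n.1 i - 1) j))) * σ.zeta_sq

lemma ConservesNumber.parity_mul {A : FockOp σ d} (hA : ConservesNumber A) :
    parity σ d * A = A * parity σ d := by
  have key : ∀ (N : ℕ) (φ : FockV σ d), φ ∈ nParticle σ d N →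
      parity σ d φ = σ.zeta ^ N • φ := by
    intro N φ hφ
    rw [mem_nParticle] at hφ
    have h1 : φ = ∑ n ∈ φ.support, φ n • ket n := by
      conv_lhs => rw [← Finsupp.sum_single φ]
      simp [Finsupp.sum, ket]
    rw [h1, map_sum, Finset.smul_sum]
    refine Finset.sum_congr rfl fun n hn => ?_
    rw [map_smul, parity_ket, hφ n (Finsupp.mem_support_iff.1 hn), smul_comm]
  refine FockOp.ext_ket fun n => ?_
  rw [Module.End.mul_apply, Module.End.mul_apply, parity_ket, map_smul,
    key _ _ (hA _ _ (ket_mem_nParticle n))]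

lemma oneBody_parity (h : Matrix (Fin d) (Fin d) ℂ) :
    parity σ d * oneBody h = oneBody h * parity σ d := by
  have h1 : ∀ i j : Fin d, parity σ d * (creat i * annih j) = creat i * annih j * parity σ d := by
    intro i j
    rw [← mul_assoc, parity_mul_creat, smul_mul_assoc, mul_assoc, parity_mul_annih, mul_smul_comm,
      smul_smul, σ.zeta_sq, one_smul, mul_assoc]
  simp only [oneBody, Finset.mul_sum, Finset.sum_mul, mul_smul_comm, smul_mul_assoc, h1]

/-- If `B` is ζ-commuting with all generators of the fragment algebra, then moving `B` through an
element of that algebra conjugates the element with the parity. -/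
lemma mul_eq_parity_conj_mul {p : ℕ} {B : FockOp σ d}
    (ha : ∀ k : Fin d, (k : ℕ) < p → B * annih k = σ.zeta • (annih k * B))
    (hc : ∀ k : Fin d, (k : ℕ) < p → B * creat k = σ.zeta • (creat k * B))
    {W : FockOp σ d} (hW : W ∈ fragmentAlgebra σ d p) :
    B * W = parity σ d * W * parity σ d * B := by
  induction hW using Algebra.adjoin_induction with
  | mem A hA =>
    obtain ⟨k, hk, rfl | rfl⟩ := hA
    · rw [ha k hk, parity_mul_annih, smul_mul_assoc, smul_mul_assoc, mul_assoc (annih k),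
        parity_mul_self, mul_one]
    · rw [hc k hk, parity_mul_creat, smul_mul_assoc, smul_mul_assoc, mul_assoc (creat k),
        parity_mul_self, mul_one]
  | algebraMap r =>
    rw [← Algebra.commutes r (parity σ d), mul_assoc (algebraMap _ _ r), parity_mul_self, mul_one,
      Algebra.commutes]
  | add A A' _ _ h1 h2 => simp only [mul_add, add_mul, h1, h2]
  | mul A A' _ _ h1 h2 =>
    rw [← mul_assoc, h1, mul_assoc, h2]
    simp only [mul_assoc]
    rw [← mul_assoc (parity σ d) (parity σ d), parity_mul_self, one_mul]

/-! ### Commutators with an impurity Hamiltonian -/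

/-- The interaction part of a number-conserving impurity Hamiltonian commutes with every operator
that ζ-commutes with the fragment, because it is even. -/
lemma commute_interaction {p : ℕ} {h : Matrix (Fin d) (Fin d) ℂ} {A W B : FockOp σ d}
    (hA : ConservesNumber A) (hW : W ∈ fragmentAlgebra σ d p) (hAW : A = oneBody h + W)
    (ha : ∀ k : Fin d, (k : ℕ) < p → B * annih k = σ.zeta • (annih k * B))
    (hc : ∀ k : Fin d, (k : ℕ) < p → B * creat k = σ.zeta • (creat k * B)) :
    B * W = W * B := by
  have h1 : parity σ d * W = W * parity σ d := by
    have h2 := hA.parity_mul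
    rw [hAW, mul_add, add_mul, oneBody_parity] at h2
    exact LinearMap.ext fun φ => add_left_cancel (DFunLike.congr_fun h2 φ)
  rw [mul_eq_parity_conj_mul ha hc hW, h1, mul_assoc W, parity_mul_self, mul_one]

lemma annih_mul_oneBody (h : Matrix (Fin d) (Fin d) ℂ) (i : Fin d) :
    (annih i * oneBody h : FockOp σ d) = oneBody h * annih i + ∑ l, h i l • annih l := by
  have h1 : ∀ k l : Fin d, (annih i * (creat k * annih l) : FockOp σ d) =
      creat k * annih l * annih i + (1 : Matrix (Fin d) (Fin d) ℂ) i k • annih l := by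
    intro k l
    rw [← mul_assoc, annih_mul_creat, add_mul, smul_mul_assoc, mul_assoc, annih_mul_annih i l,
      mul_smul_comm, smul_smul, σ.zeta_sq, one_smul, smul_mul_assoc, one_mul, mul_assoc]
  simp only [oneBody, Finset.mul_sum, Finset.sum_mul, mul_smul_comm, smul_mul_assoc, h1, smul_add,
    Finset.sum_add_distrib]
  congr 1
  rw [Finset.sum_eq_single i]
  · simp
  · intro k _ hk
    simp [Matrix.one_apply_ne hk.symm]
  · simp

lemma oneBody_mul_creat (h : Matrix (Fin d) (Fin d) ℂ) (j : Fin d) :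
    (oneBody h * creat j : FockOp σ d) = creat j * oneBody h + ∑ l, h l j • creat l := by
  have h1 : ∀ k l : Fin d, (creat k * annih l * creat j : FockOp σ d) =
      creat j * (creat k * annih l) + (1 : Matrix (Fin d) (Fin d) ℂ) l j • creat k := by
    intro k l
    rw [mul_assoc, annih_mul_creat, mul_add, mul_smul_comm, ← mul_assoc, creat_mul_creat k j,
      smul_mul_assoc, smul_smul, σ.zeta_sq, one_smul, mul_smul_comm, mul_one, mul_assoc]
  simp only [oneBody, Finset.mul_sum, Finset.sum_mul, mul_smul_comm, smul_mul_assoc, h1, smul_add,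
    Finset.sum_add_distrib]
  congr 1
  refine Finset.sum_congr rfl fun k _ => ?_
  rw [Finset.sum_eq_single j]
  · simp
  · intro l _ hl
    simp [Matrix.one_apply_ne hl]
  · simp

theorem annih_mul_hamiltonian {p : ℕ} {h : Matrix (Fin d) (Fin d) ℂ} {A W : FockOp σ d}
    (hA : ConservesNumber A) (hW : W ∈ fragmentAlgebra σ d p) (hAW : A = oneBody h + W)
    {i : Fin d} (hi : p ≤ i) :
    annih i * A = A * annih i + ∑ l, h i l • annih l := by
  have h1 : annih i * W = W * annih i :=
    commute_interaction hA hW hAW (fun k _ => annih_mul_annih i k) fun k hk =>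
      annih_mul_creat_of_ne (by rintro rfl; omega)
  rw [hAW, mul_add, annih_mul_oneBody, h1, add_mul]
  abel

theorem hamiltonian_mul_creat {p : ℕ} {h : Matrix (Fin d) (Fin d) ℂ} {A W : FockOp σ d}
    (hA : ConservesNumber A) (hW : W ∈ fragmentAlgebra σ d p) (hAW : A = oneBody h + W)
    {j : Fin d} (hj : p ≤ j) :
    A * creat j = creat j * A + ∑ l, h l j • creat l := by
  have h1 : creat j * W = W * creat j :=
    commute_interaction hA hW hAW
      (fun k hk => by
        rw [annih_mul_creat_of_ne (show k ≠ j by rintro rfl; omega), smul_smul, σ.zeta_sq,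
          one_smul])
      fun k _ => creat_mul_creat j k
  rw [hAW, add_mul, oneBody_mul_creat, mul_add, h1]
  abel

/-! ### The hopping matrix in terms of matrix elements of the Hamiltonian -/

/-- The state without particles. -/
def Occ.vac (σ : Statistics) (d : ℕ) : Occ σ d := ⟨fun _ => 0, fun _ _ => Nat.zero_le _⟩

/-- The state with one particle, in the state `i`. -/
def Occ.one (σ : Statistics) (i : Fin d) : Occ σ d :=
  (Occ.vac σ d).raise i fun h => zero_ne_one h.2

lemma creat_vac (i : Fin d) : creat i (ket (Occ.vac σ d)) = ket (Occ.one σ i) := by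
  rw [← ketOf_val, creat_ketOf, ← ketOf_val]
  have h1 : signOf σ (Occ.vac σ d).1 i = 1 := by simp [signOf, Occ.vac]
  rw [h1]
  simp [Occ.one, Occ.raise, Occ.vac]

lemma annih_vac (i : Fin d) : annih i (ket (Occ.vac σ d)) = 0 := by
  rw [annih_ket]
  simp [Occ.vac]

lemma annih_one (i l : Fin d) : annih i (ket (Occ.one σ l)) =
    (1 : Matrix (Fin d) (Fin d) ℂ) i l • ket (Occ.vac σ d) := by
  rw [← creat_vac, ← Module.End.mul_apply, annih_mul_creat]
  simp [annih_vac]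

lemma Occ.one_injective : Function.Injective (Occ.one σ : Fin d → Occ σ d) := by
  intro i l h
  by_contra hil
  have := congrFun (congrArg Subtype.val h) i
  simp [Occ.one, Occ.raise, Occ.vac, Function.update_of_ne hil] at this

lemma annih_apply_vac (i : Fin d) (φ : FockV σ d) :
    annih i φ (Occ.vac σ d) = φ (Occ.one σ i) := by
  induction φ using FockV.induction_ket with
  | h0 => simp
  | hadd φ ψ h1 h2 => simp [h1, h2]
  | hket c n =>
    rw [map_smul, Finsupp.smul_apply, Finsupp.smul_apply]
    congr 1
    by_cases hn : n = Occ.one σ i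
    · subst hn
      simp [annih_one, ket_apply_self]
    · rw [ket_apply_of_ne hn, annih_ket, Finsupp.smul_apply]
      by_cases h0 : n.1 i = 0
      · simp [h0]
      rw [show ketOf σ (Function.update n.1 i (n.1 i - 1)) = ket (n.lower i) from
        ketOf_val (n.lower i), ket_apply_of_ne, smul_zero]
      intro h
      refine hn (Subtype.ext (funext fun j => ?_))
      have hj := congrFun (congrArg Subtype.val h) j
      by_cases hji : j = i
      · subst hji
        simp only [Occ.lower, Occ.vac, Function.update_self] at hj
        simp only [Occ.one, Occ.raise, Occ.vac, Function.update_self]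
        omega
      · simp only [Occ.lower, Occ.vac, Function.update_of_ne hji] at hj
        simp [Occ.one, Occ.raise, Occ.vac, Function.update_of_ne hji, hj]

lemma ConservesNumber.apply_vac {A : FockOp σ d} (hA : ConservesNumber A) :
    A (ket (Occ.vac σ d)) = matElem (Occ.vac σ d) A (Occ.vac σ d) • ket (Occ.vac σ d) := by
  ext n
  by_cases hn : n = Occ.vac σ d
  · subst hn
    simp [matElem, ket_apply_self]
  · rw [Finsupp.smul_apply, ket_apply_of_ne (Ne.symm hn), smul_zero]
    refine hA.matElem_eq_zero fun h => hn (Subtype.ext (funext fun i => ?_))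
    have h1 : ∑ j, n.1 j = 0 := by simpa [Occ.total, Occ.vac] using h
    exact (Finset.sum_eq_zero_iff.1 h1) i (Finset.mem_univ i)

/-- Outside of the fragment, the rows and columns of `h` are determined by the Hamiltonian. -/
theorem hopping_eq_matElem {p : ℕ} {h : Matrix (Fin d) (Fin d) ℂ} {A W : FockOp σ d}
    (hA : ConservesNumber A) (hW : W ∈ fragmentAlgebra σ d p) (hAW : A = oneBody h + W)
    {i l : Fin d} (hil : p ≤ (i : ℕ) ∨ p ≤ (l : ℕ)) :
    h i l = matElem (Occ.one σ i) A (Occ.one σ l) -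
      (1 : Matrix (Fin d) (Fin d) ℂ) i l * matElem (Occ.vac σ d) A (Occ.vac σ d) := by
  rcases hil with hi | hl
  · have h1 := congrArg (fun B : FockOp σ d => B (ket (Occ.one σ l)) (Occ.vac σ d))
      (annih_mul_hamiltonian hA hW hAW hi)
    simp only [Module.End.mul_apply, LinearMap.add_apply, Finsupp.add_apply, annih_apply_vac,
      annih_one, map_smul, LinearMap.sum_apply, LinearMap.smul_apply, Finsupp.coe_smul,
      Pi.smul_apply, Finsupp.coe_finsetSum, Finset.sum_apply, ket_apply_self, smul_eq_mul,
      mul_one] at h1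
    rw [Finset.sum_eq_single l (by intro k _ hk; simp [Matrix.one_apply_ne hk]) (by simp),
      Matrix.one_apply_eq, mul_one] at h1
    simp only [matElem]
    linear_combination -h1
  · have h1 := congrArg (fun B : FockOp σ d => B (ket (Occ.vac σ d)) (Occ.one σ i))
      (hamiltonian_mul_creat hA hW hAW hl)
    simp only [Module.End.mul_apply, LinearMap.add_apply, Finsupp.add_apply, creat_vac,
      hA.apply_vac, map_smul, LinearMap.sum_apply, LinearMap.smul_apply, Finsupp.coe_smul,
      Pi.smul_apply, Finsupp.coe_finsetSum, Finset.sum_apply, smul_eq_mul] at h1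
    rw [Finset.sum_eq_single i (by
      intro k _ hk; rw [ket_apply_of_ne (Occ.one_injective.ne hk), mul_zero]) (by simp),
      ket_apply_self, mul_one] at h1
    have h2 : ket (Occ.one σ l) (Occ.one σ i) = (1 : Matrix (Fin d) (Fin d) ℂ) i l := by
      by_cases hil : i = l
      · subst hil
        rw [ket_apply_self, Matrix.one_apply_eq]
      · rw [ket_apply_of_ne (Occ.one_injective.ne (Ne.symm hil)), Matrix.one_apply_ne hil]
    rw [h2] at h1
    rw [matElem]
    linear_combination -h1

/-! ### Piecewise continuous and essentially bounded functions -/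

lemma PiecewiseContinuousOn.exists_bound {f : ℝ → ℂ} {a b : ℝ}
    (hf : PiecewiseContinuousOn f a b) : ∃ C, ∀ s ∈ Icc a b, ‖f s‖ ≤ C := by
  refine isCompact_Icc.induction_on (p := fun S => ∃ C, ∀ s ∈ S, ‖f s‖ ≤ C) ⟨0, by simp⟩
    (fun S S' h ⟨C, hC⟩ => ⟨C, fun s hs => hC s (h hs)⟩) ?_ ?_
  · rintro S S' ⟨C, hC⟩ ⟨C', hC'⟩
    refine ⟨max C C', ?_⟩
    rintro s (hs | hs)
    · exact (hC s hs).trans (le_max_left _ _)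
    · exact (hC' s hs).trans (le_max_right _ _)
  · intro x hx
    obtain ⟨⟨l, hl⟩, r, hr⟩ := hf.2 x hx
    obtain ⟨Cl, hCl⟩ : ∃ C, ∀ᶠ s in 𝓝[Icc a b ∩ Iio x] x, ‖f s‖ ≤ C :=
      ⟨‖l‖ + 1, (hl.norm.eventually_lt_const (lt_add_one _)).mono fun _ h => h.le⟩
    obtain ⟨Cr, hCr⟩ : ∃ C, ∀ᶠ s in 𝓝[Icc a b ∩ Ioi x] x, ‖f s‖ ≤ C :=
      ⟨‖r‖ + 1, (hr.norm.eventually_lt_const (lt_add_one _)).mono fun _ h => h.le⟩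
    refine ⟨{s | ‖f s‖ ≤ max (max Cl Cr) ‖f x‖}, ?_, _, fun s hs => hs⟩
    rw [eventually_nhdsWithin_iff] at hCl hCr
    change ∀ᶠ s in 𝓝[Icc a b] x, _
    rw [eventually_nhdsWithin_iff]
    filter_upwards [hCl, hCr] with s h1 h2 hs
    rcases lt_trichotomy s x with h | rfl | h
    · exact (h1 ⟨hs, h⟩).trans ((le_max_left _ _).trans (le_max_left _ _))
    · exact le_max_right _ _
    · exact (h2 ⟨hs, h⟩).trans ((le_max_right _ _).trans (le_max_left _ _))

lemma PiecewiseContinuousOn.aestronglyMeasurable {f : ℝ → ℂ} {a b : ℝ}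
    (hf : PiecewiseContinuousOn f a b) :
    AEStronglyMeasurable f (volume.restrict (Ioo a b)) := by
  obtain ⟨P, hP⟩ := hf.1
  have h1 : ContinuousOn f (Ioo a b \ P) := fun s hs =>
    (hP s (Ioo_subset_Icc_self hs.1) hs.2).mono (sdiff_subset.trans Ioo_subset_Icc_self)
  have h2 := h1.aestronglyMeasurable (μ := volume) (measurableSet_Ioo.diff P.measurableSet)
  rwa [Measure.restrict_congr_set
    (sdiff_null_ae_eq_self (P.finite_toSet.measure_zero volume))] at h2

lemma PiecewiseContinuousOn.memLp_top {f : ℝ → ℂ} {a b : ℝ}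
    (hf : PiecewiseContinuousOn f a b) : MemLp f ⊤ (volume.restrict (Ioo a b)) := by
  obtain ⟨C, hC⟩ := hf.exists_bound
  exact memLp_top_of_bound hf.aestronglyMeasurable C
    (ae_restrict_of_forall_mem measurableSet_Ioo fun s hs => hC s (Ioo_subset_Icc_self hs))

section

variable {α E : Type*} [MeasurableSpace α] {μ : Measure α} [NormedAddCommGroup E]

lemma MeasureTheory.MemLp.exists_ae_bound {f : α → E} (hf : MemLp f ⊤ μ) :
    ∃ C : ℝ, 0 ≤ C ∧ ∀ᵐ x ∂μ, ‖f x‖ ≤ C := by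
  refine ⟨(eLpNormEssSup f μ).toReal, ENNReal.toReal_nonneg, ?_⟩
  have h1 : eLpNormEssSup f μ ≠ ⊤ := by
    rw [← eLpNorm_exponent_top]
    exact hf.eLpNorm_ne_top
  filter_upwards [ae_le_eLpNormEssSup (f := f) (μ := μ)] with x hx
  rw [← toReal_enorm]
  exact ENNReal.toReal_mono h1 hx

lemma MeasureTheory.MemLp.top_comp_quasiMeasurePreserving {β : Type*} [MeasurableSpace β]
    {ν : Measure β} {f : α → E} (hf : MemLp f ⊤ μ) {g : β → α}
    (hg : Measure.QuasiMeasurePreserving g ν μ) : MemLp (f ∘ g) ⊤ ν := by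
  obtain ⟨C, -, hC⟩ := hf.exists_ae_bound
  exact memLp_top_of_bound (hf.1.comp_quasiMeasurePreserving hg) C (hg.ae hC)

lemma ContinuousOn.memLp_top [TopologicalSpace α] [OpensMeasurableSpace α]
    [TopologicalSpace.PseudoMetrizableSpace α] [SecondCountableTopologyEither α E]
    {ν : Measure α} {f : α → E} {K S : Set α}
    (hf : ContinuousOn f K) (hK : IsCompact K) (hS : MeasurableSet S) (hSK : S ⊆ K) :
    MemLp f ⊤ (ν.restrict S) := by
  obtain ⟨C, hC⟩ := hK.exists_bound_of_continuousOn hf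
  exact memLp_top_of_bound ((hf.mono hSK).aestronglyMeasurable hS) C
    (ae_restrict_of_forall_mem hS fun s hs => hC s (hSK hs))

end

lemma quasiMeasurePreserving_fst_Ioo (a b : ℝ) :
    Measure.QuasiMeasurePreserving Prod.fst (volume.restrict (Ioo a b ×ˢ Ioo a b))
      (volume.restrict (Ioo a b)) := by
  rw [Measure.volume_eq_prod, ← Measure.prod_restrict]
  exact Measure.quasiMeasurePreserving_fst

lemma quasiMeasurePreserving_snd_Ioo (a b : ℝ) :
    Measure.QuasiMeasurePreserving Prod.snd (volume.restrict (Ioo a b ×ˢ Ioo a b))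
      (volume.restrict (Ioo a b)) := by
  rw [Measure.volume_eq_prod, ← Measure.prod_restrict]
  exact Measure.quasiMeasurePreserving_snd

/-! ### Linear differential equations with exceptional points -/

section

variable {R : Type*} [NormedRing R] [NormedAlgebra ℝ R] [CompleteSpace R]

/-- Uniqueness for linear equations whose coefficients are only essentially bounded, and which hold
off a finite set: `‖y s‖ ≤ C ∫ ‖y‖`, and Grönwall's inequality applies to `∫ ‖y‖`. -/
theorem eq_zero_of_linear_ode {y K : ℝ → R} {a b : ℝ} {P : Set ℝ} (hP : P.Finite)
    (hy : ContinuousOn y (Icc a b))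
    (hd : ∀ s ∈ Ioo a b, s ∉ P → HasDerivAt y (K s * y s) s)
    (hK : MemLp K ⊤ (volume.restrict (Ioo a b))) (h0 : y a = 0) :
    ∀ s ∈ Icc a b, y s = 0 := by
  intro s hs
  have hab : a ≤ b := hs.1.trans hs.2
  obtain ⟨C, hC0, hC⟩ := hK.exists_ae_bound
  have hint : IntegrableOn (fun s => K s * y s) (Ioo a b) := by
    have h1 : MemLp y ⊤ (volume.restrict (Ioo a b)) :=
      hy.memLp_top isCompact_Icc measurableSet_Ioo Ioo_subset_Icc_self
    have h2 : MemLp (fun s => K s * y s) ⊤ (volume.restrict (Ioo a b)) := h1.mul' hK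
    exact h2.integrable le_top
  set v : ℝ → ℝ := fun t => ‖y (projIcc a b hab t)‖ with hv
  have hvc : Continuous v :=
    ((continuousOn_iff_continuous_domRestrict.1 hy).comp continuous_projIcc).norm
  have hvy : ∀ t ∈ Icc a b, v t = ‖y t‖ := fun t ht => by rw [hv]; simp [projIcc_of_mem hab ht]
  set g : ℝ → ℝ := fun t => ∫ r in a..t, v r with hg
  have hgd : ∀ t, HasDerivAt g (v t) t := fun t =>
    intervalIntegral.integral_hasDerivAt_right (hvc.intervalIntegrable _ _)
      hvc.stronglyMeasurable.stronglyMeasurableAtFilter hvc.continuousAt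
  have hbound : ∀ t ∈ Icc a b, v t ≤ C * g t := by
    intro t ht
    have hsub : Ioo a t ⊆ Ioo a b := Ioo_subset_Ioo_right ht.2
    have hi : IntegrableOn (fun s => K s * y s) (Ioc a t) :=
      (integrableOn_Ioc_iff_integrableOn_Ioo (by finiteness)).2 (hint.mono_set hsub)
    have h1 : ∫ r in a..t, K r * y r = y t - y a :=
      integral_eq_of_hasDerivAt_off_countable_of_le _ _ ht.1 hP.countable
        (hy.mono (Icc_subset_Icc_right ht.2)) (fun r hr => hd r (hsub hr.1) hr.2)
        ((intervalIntegrable_iff_integrableOn_Ioc_of_le ht.1).2 hi)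
    rw [h0, sub_zero] at h1
    rw [hvy t ht, ← h1, hg, ← intervalIntegral.integral_const_mul]
    refine intervalIntegral.norm_integral_le_of_norm_le ht.1 ?_
      ((hvc.const_smul C).intervalIntegrable _ _)
    have h2 : ∀ᵐ r ∂(volume.restrict (Ioo a b)), ‖K r * y r‖ ≤ C * v r := by
      filter_upwards [hC, ae_restrict_mem measurableSet_Ioo] with r hr hr'
      rw [hvy r (Ioo_subset_Icc_self hr')]
      exact (norm_mul_le _ _).trans (by gcongr)
    rw [ae_restrict_iff' measurableSet_Ioo] at h2
    have h3 : ∀ᵐ r : ℝ, r ≠ t := by simp [ae_iff]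
    filter_upwards [h2, h3] with r h4 h5 h6
    exact h4 (hsub ⟨h6.1, lt_of_le_of_ne h6.2 h5⟩)
  have hg0 : ∀ t ∈ Icc a b, 0 ≤ g t := fun t ht =>
    intervalIntegral.integral_nonneg ht.1 fun r _ => norm_nonneg _
  have h1 := norm_le_gronwallBound_of_norm_deriv_right_le (f := g) (f' := v) (δ := 0) (K := C)
    (ε := 0) (a := a) (b := b) (fun t _ => (hgd t).continuousAt.continuousWithinAt)
    (fun t _ => (hgd t).hasDerivWithinAt) (by simp [hg])
    (fun t ht => by
      have ht' := Ico_subset_Icc_self ht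
      rw [Real.norm_of_nonneg (norm_nonneg _), Real.norm_of_nonneg (hg0 t ht'), add_zero]
      exact hbound t ht') s hs
  rw [gronwallBound_ε0, zero_mul, norm_le_zero_iff] at h1
  have h2 := hbound s hs
  rw [h1, mul_zero, hvy s hs, norm_le_zero_iff] at h2
  exact h2

/-- The operator `A` in the Heisenberg picture of the evolution `T`, which is meaningful where `T s`
is a unit. -/
noncomputable def heisenberg (T : ℝ → R) (A : R) (s : ℝ) : R := Ring.inverse (T s) * A * T s

omit [NormedAlgebra ℝ R] in
lemma ContinuousOn.heisenberg {T : ℝ → R} {S : Set ℝ} (hT : ContinuousOn T S)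
    (hu : ∀ s ∈ S, IsUnit (T s)) (A : R) : ContinuousOn (heisenberg T A) S := by
  refine ContinuousOn.mul (ContinuousOn.mul ?_ continuousOn_const) hT
  intro s hs
  obtain ⟨u, hu'⟩ := hu s hs
  have h1 : ContinuousAt Ring.inverse (T s) := hu' ▸ NormedRing.inverse_continuousAt u
  exact h1.comp_continuousWithinAt (hT s hs)

/-- Heisenberg's equation of motion. -/
lemma HasDerivAt.heisenberg {T : ℝ → R} {K : R} {s : ℝ} (hT : HasDerivAt T (K * T s) s)
    (hu : IsUnit (T s)) (A : R) :
    HasDerivAt (heisenberg T A) (Ring.inverse (T s) * (A * K - K * A) * T s) s := by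
  obtain ⟨u, hu'⟩ := hu
  have h1 : HasFDerivAt Ring.inverse (-ContinuousLinearMap.mulLeftRight ℝ R ↑u⁻¹ ↑u⁻¹) (T s) :=
    hu' ▸ hasFDerivAt_ringInverse u
  have h2 := (((h1.comp_hasDerivAt s hT).mul_const A).mul hT)
  refine h2.congr_deriv ?_
  have h3 : Ring.inverse (T s) = ↑u⁻¹ := by rw [← hu', Ring.inverse_unit]
  simp only [Function.comp_apply, h3, neg_apply,
    ContinuousLinearMap.mulLeftRight_apply]
  rw [← hu']
  simp only [mul_assoc, mul_sub, sub_mul, Units.mul_inv, mul_one, neg_mul]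
  abel

end

/-! ### Distributional derivatives of kernels with a jump on the diagonal -/

lemma integral_mul_deriv_add_of_jump {a b t : ℝ} (ht : t ∈ Ioo a b) {P : Set ℝ} (hP : P.Countable)
    {fr fl kr kl g k ψ ψ' : ℝ → ℂ} (hfr : ContinuousOn fr (Icc a b))
    (hfl : ContinuousOn fl (Icc a b))
    (hdr : ∀ s ∈ Ioo a b, s ∉ P → HasDerivAt fr (kr s) s)
    (hdl : ∀ s ∈ Ioo a b, s ∉ P → HasDerivAt fl (kl s) s)
    (hgr : ∀ s ∈ Ioo a b, t < s → g s = fr s) (hgl : ∀ s ∈ Ioo a b, s < t → g s = fl s)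
    (hkr : ∀ s ∈ Ioo a b, t < s → k s = kr s) (hkl : ∀ s ∈ Ioo a b, s < t → k s = kl s)
    (hk : IntegrableOn k (Ioo a b)) (hψ : ∀ s, HasDerivAt ψ (ψ' s) s) (hψ' : Continuous ψ')
    (ha : ψ a = 0) (hb : ψ b = 0) :
    ∫ s in Ioo a b, (g s * ψ' s + k s * ψ s) = (fl t - fr t) * ψ t := by
  have hψc : Continuous ψ := continuous_iff_continuousAt.2 fun s => (hψ s).continuousAt
  -- the fundamental theorem of calculus on each side of the jump
  have key : ∀ {u v : ℝ} {f κ : ℝ → ℂ}, u ≤ v → Icc u v ⊆ Icc a b → Ioo u v ⊆ Ioo a b →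
      ContinuousOn f (Icc a b) → (∀ s ∈ Ioo a b, s ∉ P → HasDerivAt f (κ s) s) →
      (∀ s ∈ Ioo u v, g s = f s) → (∀ s ∈ Ioo u v, k s = κ s) →
      IntegrableOn (fun s => g s * ψ' s + k s * ψ s) (Ioc u v) ∧
        ∫ s in u..v, (g s * ψ' s + k s * ψ s) = f v * ψ v - f u * ψ u := by
    intro u v f κ huv hcc hoo hf hd hgf hkκ
    have hκ : IntegrableOn κ (Ioo u v) :=
      (hk.mono_set hoo).congr_fun hkκ measurableSet_Ioo
    have hI : IntegrableOn (fun s => f s * ψ' s + κ s * ψ s) (Ioo u v) := by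
      refine Integrable.add ?_ ?_
      · exact (((hf.mono hcc).mul hψ'.continuousOn).integrableOn_Icc).mono_set Ioo_subset_Icc_self
      · have h1 : MemLp ψ ⊤ (volume.restrict (Ioo u v)) :=
          hψc.continuousOn.memLp_top isCompact_Icc measurableSet_Ioo Ioo_subset_Icc_self
        exact hκ.mul_of_top_left h1
    have heq : ∀ s ∈ Ioo u v, f s * ψ' s + κ s * ψ s = g s * ψ' s + k s * ψ s := fun s hs => by
      rw [hgf s hs, hkκ s hs]
    refine ⟨(integrableOn_Ioc_iff_integrableOn_Ioo (by finiteness)).2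
      (hI.congr_fun heq measurableSet_Ioo), ?_⟩
    rw [intervalIntegral.integral_of_le huv, integral_Ioc_eq_integral_Ioo,
      ← setIntegral_congr_fun measurableSet_Ioo heq, ← integral_Ioc_eq_integral_Ioo,
      ← intervalIntegral.integral_of_le huv]
    refine integral_eq_of_hasDerivAt_off_countable_of_le (fun s => f s * ψ s) _ huv hP
      ((hf.mono hcc).mul hψc.continuousOn) (fun s hs => ?_)
      ((intervalIntegrable_iff_integrableOn_Ioc_of_le huv).2
        ((integrableOn_Ioc_iff_integrableOn_Ioo (by finiteness)).2 hI))
    refine ((hd s (hoo hs.1) hs.2).mul (hψ s)).congr_deriv ?_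
    ring
  obtain ⟨hi1, h1⟩ := key ht.1.le (Icc_subset_Icc_right ht.2.le) (Ioo_subset_Ioo_right ht.2.le)
    hfl hdl (fun s hs => hgl s ⟨hs.1, hs.2.trans ht.2⟩ hs.2)
    (fun s hs => hkl s ⟨hs.1, hs.2.trans ht.2⟩ hs.2)
  obtain ⟨hi2, h2⟩ := key ht.2.le (Icc_subset_Icc_left ht.1.le) (Ioo_subset_Ioo_left ht.1.le)
    hfr hdr (fun s hs => hgr s ⟨ht.1.trans hs.1, hs.2⟩ hs.1)
    (fun s hs => hkr s ⟨ht.1.trans hs.1, hs.2⟩ hs.1)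
  rw [← integral_Ioc_eq_integral_Ioo, ← intervalIntegral.integral_of_le (ht.1.trans ht.2).le,
    ← intervalIntegral.integral_add_adjacent_intervals
      ((intervalIntegrable_iff_integrableOn_Ioc_of_le ht.1.le).2 hi1)
      ((intervalIntegrable_iff_integrableOn_Ioc_of_le ht.2.le).2 hi2), h1, h2, ha, hb]
  ring

lemma IsTestFunction.eq_zero {a b : ℝ} {φ : ℝ × ℝ → ℂ} (hφ : IsTestFunction a b φ) {x : ℝ × ℝ}
    (hx : x ∉ Ioo a b ×ˢ Ioo a b) : φ x = 0 :=
  image_eq_zero_of_notMem_tsupport fun h => hx (hφ.2.2 h)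

lemma IsTestFunction.continuous_fderiv {a b : ℝ} {φ : ℝ × ℝ → ℂ} (hφ : IsTestFunction a b φ)
    (v : ℝ × ℝ) : Continuous fun x => fderiv ℝ φ x v :=
  (hφ.1.continuous_fderiv (by simp)).clm_apply continuous_const

/-- A bounded continuous weight preserves integrability on the (relatively compact) square. -/
lemma integrableOn_mul_continuous {a b : ℝ} {g ψ : ℝ × ℝ → ℂ}
    (hg : IntegrableOn g (Ioo a b ×ˢ Ioo a b)) (hψ : Continuous ψ) :
    IntegrableOn (fun x => g x * ψ x) (Ioo a b ×ˢ Ioo a b) := by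
  have h1 : MemLp ψ ⊤ (volume.restrict (Ioo a b ×ˢ Ioo a b)) :=
    hψ.continuousOn.memLp_top (isCompact_Icc.prod isCompact_Icc)
      (measurableSet_Ioo.prod measurableSet_Ioo)
      (prod_mono (Ioo_subset_Icc_self (a := a) (b := b)) Ioo_subset_Icc_self)
  exact Integrable.mul_of_top_left hg h1

/-- A kernel which is differentiable in its first argument off the diagonal, with derivative `k` and
with the jump `J` along the diagonal, has the distributional derivative `k + J δ(s - s')`. -/
theorem integral_mul_fderiv_fst {a b : ℝ} {P : Set ℝ} (hP : P.Countable)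
    {fr fl kr kl g k φ : ℝ × ℝ → ℂ} {J : ℂ}
    (hfr : ContinuousOn fr (Icc a b ×ˢ Icc a b)) (hfl : ContinuousOn fl (Icc a b ×ˢ Icc a b))
    (hdr : ∀ s ∈ Ioo a b, s ∉ P → ∀ t ∈ Ioo a b, HasDerivAt (fun r => fr (r, t)) (kr (s, t)) s)
    (hdl : ∀ s ∈ Ioo a b, s ∉ P → ∀ t ∈ Ioo a b, HasDerivAt (fun r => fl (r, t)) (kl (s, t)) s)
    (hgr : ∀ s ∈ Ioo a b, ∀ t ∈ Ioo a b, t < s → g (s, t) = fr (s, t))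
    (hgl : ∀ s ∈ Ioo a b, ∀ t ∈ Ioo a b, s < t → g (s, t) = fl (s, t))
    (hkr : ∀ s ∈ Ioo a b, ∀ t ∈ Ioo a b, t < s → k (s, t) = kr (s, t))
    (hkl : ∀ s ∈ Ioo a b, ∀ t ∈ Ioo a b, s < t → k (s, t) = kl (s, t))
    (hJ : ∀ t ∈ Ioo a b, fr (t, t) - fl (t, t) = J)
    (hg : IntegrableOn g (Ioo a b ×ˢ Ioo a b)) (hk : IntegrableOn k (Ioo a b ×ˢ Ioo a b))
    (hφ : IsTestFunction a b φ) :
    (∫ x in Ioo a b ×ˢ Ioo a b, g x * fderiv ℝ φ x (1, 0)) +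
      ∫ x in Ioo a b ×ˢ Ioo a b, k x * φ x = -J * ∫ t in Ioo a b, φ (t, t) := by
  have hgi := integrableOn_mul_continuous hg (hφ.continuous_fderiv (1, 0))
  have hki := integrableOn_mul_continuous hk hφ.1.continuous
  rw [← integral_add hgi hki, ← integral_const_mul]
  have hadd := hgi.add hki
  rw [IntegrableOn, Measure.volume_eq_prod, ← Measure.prod_restrict] at hk hadd
  rw [Measure.volume_eq_prod, ← Measure.prod_restrict]
  refine (integral_prod_symm _ hadd).trans (integral_congr_ae ?_)
  filter_upwards [hk.prod_left_ae, ae_restrict_mem measurableSet_Ioo] with t hkt ht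
  have hslice : ∀ s : ℝ, HasDerivAt (fun r => φ (r, t)) (fderiv ℝ φ (s, t) (1, 0)) s := by
    intro s
    have h1 : HasFDerivAt φ (fderiv ℝ φ (s, t)) (s, t) :=
      (hφ.1.differentiable (by simp) (s, t)).hasFDerivAt
    exact h1.comp_hasDerivAt s ((hasDerivAt_id s).prodMk (hasDerivAt_const s t))
  have hpair : ContinuousOn (fun r : ℝ => (r, t)) (Icc a b) := by fun_prop
  have hmaps : MapsTo (fun r : ℝ => (r, t)) (Icc a b) (Icc a b ×ˢ Icc a b) := fun r hr =>
    ⟨hr, Ioo_subset_Icc_self ht⟩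
  refine (integral_mul_deriv_add_of_jump (t := t) ht hP (fr := fun s => fr (s, t))
    (fl := fun s => fl (s, t)) (kr := fun s => kr (s, t)) (kl := fun s => kl (s, t))
    (g := fun s => g (s, t)) (k := fun s => k (s, t)) (ψ := fun s => φ (s, t))
    (hfr.comp hpair hmaps) (hfl.comp hpair hmaps)
    (fun s hs hsP => hdr s hs hsP t ht) (fun s hs hsP => hdl s hs hsP t ht)
    (fun s hs h => hgr s hs t ht h) (fun s hs h => hgl s hs t ht h)
    (fun s hs h => hkr s hs t ht h) (fun s hs h => hkl s hs t ht h) hkt hslice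
    ((hφ.continuous_fderiv (1, 0)).comp (by fun_prop))
    (hφ.eq_zero fun h => lt_irrefl _ h.1.1) (hφ.eq_zero fun h => lt_irrefl _ h.1.2)).trans ?_
  rw [← hJ t ht]
  ring

lemma IsTestFunction.comp_swap {a b : ℝ} {φ : ℝ × ℝ → ℂ} (hφ : IsTestFunction a b φ) :
    IsTestFunction a b (φ ∘ Prod.swap) := by
  have h1 : tsupport (φ ∘ Prod.swap) = Prod.swap ⁻¹' tsupport φ :=
    tsupport_comp_eq_preimage φ (Homeomorph.prodComm ℝ ℝ)
  refine ⟨hφ.1.comp (contDiff_snd.prodMk contDiff_fst),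
    hφ.2.1.comp_homeomorph (Homeomorph.prodComm ℝ ℝ), ?_⟩
  rw [h1]
  intro x hx
  exact ⟨(hφ.2.2 hx).2, (hφ.2.2 hx).1⟩

lemma integrableOn_comp_swap {a b : ℝ} {g : ℝ × ℝ → ℂ}
    (hg : IntegrableOn g (Ioo a b ×ˢ Ioo a b)) :
    IntegrableOn (g ∘ Prod.swap) (Ioo a b ×ˢ Ioo a b) := by
  rw [IntegrableOn, Measure.volume_eq_prod, ← Measure.prod_restrict] at hg ⊢
  exact hg.swap

/-- The analogue of `integral_mul_fderiv_fst` for the second argument. The jump across the diagonal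
has the opposite sign. -/
theorem integral_mul_fderiv_snd {a b : ℝ} {P : Set ℝ} (hP : P.Countable)
    {fr fl kr kl g k φ : ℝ × ℝ → ℂ} {J : ℂ}
    (hfr : ContinuousOn fr (Icc a b ×ˢ Icc a b)) (hfl : ContinuousOn fl (Icc a b ×ˢ Icc a b))
    (hdr : ∀ t ∈ Ioo a b, t ∉ P → ∀ s ∈ Ioo a b, HasDerivAt (fun r => fr (s, r)) (kr (s, t)) t)
    (hdl : ∀ t ∈ Ioo a b, t ∉ P → ∀ s ∈ Ioo a b, HasDerivAt (fun r => fl (s, r)) (kl (s, t)) t)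
    (hgr : ∀ s ∈ Ioo a b, ∀ t ∈ Ioo a b, t < s → g (s, t) = fr (s, t))
    (hgl : ∀ s ∈ Ioo a b, ∀ t ∈ Ioo a b, s < t → g (s, t) = fl (s, t))
    (hkr : ∀ s ∈ Ioo a b, ∀ t ∈ Ioo a b, t < s → k (s, t) = kr (s, t))
    (hkl : ∀ s ∈ Ioo a b, ∀ t ∈ Ioo a b, s < t → k (s, t) = kl (s, t))
    (hJ : ∀ t ∈ Ioo a b, fr (t, t) - fl (t, t) = J)
    (hg : IntegrableOn g (Ioo a b ×ˢ Ioo a b)) (hk : IntegrableOn k (Ioo a b ×ˢ Ioo a b))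
    (hφ : IsTestFunction a b φ) :
    (∫ x in Ioo a b ×ˢ Ioo a b, g x * fderiv ℝ φ x (0, 1)) +
      ∫ x in Ioo a b ×ˢ Ioo a b, k x * φ x = J * ∫ t in Ioo a b, φ (t, t) := by
  have hmaps : MapsTo Prod.swap (Icc a b ×ˢ Icc a b) (Icc a b ×ˢ Icc a b) := fun x hx =>
    ⟨hx.2, hx.1⟩
  have h1 := integral_mul_fderiv_fst (J := -J) hP (fr := fl ∘ Prod.swap) (fl := fr ∘ Prod.swap)
    (kr := kl ∘ Prod.swap) (kl := kr ∘ Prod.swap) (g := g ∘ Prod.swap) (k := k ∘ Prod.swap)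
    (φ := φ ∘ Prod.swap)
    (hfl.comp continuous_swap.continuousOn hmaps) (hfr.comp continuous_swap.continuousOn hmaps)
    hdl hdr (fun s hs t ht h => hgl t ht s hs h) (fun s hs t ht h => hgr t ht s hs h)
    (fun s hs t ht h => hkl t ht s hs h) (fun s hs t ht h => hkr t ht s hs h)
    (fun t ht => by rw [← hJ t ht]; simp) (integrableOn_comp_swap hg) (integrableOn_comp_swap hk)
    hφ.comp_swap
  have h2 : ∀ x : ℝ × ℝ, fderiv ℝ (φ ∘ Prod.swap) x (1, 0) = fderiv ℝ φ x.swap (0, 1) := by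
    intro x
    have h3 : HasFDerivAt φ (fderiv ℝ φ x.swap) x.swap :=
      (hφ.1.differentiable (by simp) x.swap).hasFDerivAt
    have h4 : HasFDerivAt Prod.swap
        ((ContinuousLinearMap.snd ℝ ℝ ℝ).prod (ContinuousLinearMap.fst ℝ ℝ ℝ)) x :=
      hasFDerivAt_snd.prodMk hasFDerivAt_fst
    rw [(h3.comp x h4).fderiv]
    simp
  simp only [h2, Function.comp_apply, neg_neg, Prod.swap_prod_mk] at h1
  rw [← h1, Measure.volume_eq_prod]
  congr 1
  · exact (setIntegral_prod_swap _ _ fun x : ℝ × ℝ => g x * fderiv ℝ φ x (0, 1)).symm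
  · exact (setIntegral_prod_swap _ _ fun x : ℝ × ℝ => k x * φ x).symm

/-! ### Truncation to boundedly many particles -/

/-- The occupation number states with at most `M` particles. -/
abbrev LowOcc (σ : Statistics) (d M : ℕ) : Type := {n : Occ σ d // n.total ≤ M}

instance LowOcc.finite (M : ℕ) : Finite (LowOcc σ d M) := by
  have h1 : ∀ (n : LowOcc σ d M) (i : Fin d), n.1.1 i < M + 1 := fun n i =>
    Nat.lt_succ_of_le ((Finset.single_le_sum (f := n.1.1) (fun _ _ => Nat.zero_le _)
      (Finset.mem_univ i)).trans n.2)
  refine Finite.of_injective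
    (fun n : LowOcc σ d M => fun i : Fin d => (⟨n.1.1 i, h1 n i⟩ : Fin (M + 1)))
    fun m n h => Subtype.ext (Subtype.ext (funext fun i => ?_))
  exact congrArg Fin.val (congrFun h i)

noncomputable instance LowOcc.fintype (M : ℕ) : Fintype (LowOcc σ d M) := Fintype.ofFinite _

noncomputable instance LowOcc.decidableEq (M : ℕ) : DecidableEq (LowOcc σ d M) :=
  Classical.decEq _

/-- The vector `φ` has at most `M` particles. -/
def IsLow (M : ℕ) (φ : FockV σ d) : Prop := ∀ n, φ n ≠ 0 → n.total ≤ M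

/-- The components of `φ` with at most `M` particles. -/
def truncVec (M : ℕ) (φ : FockV σ d) : LowOcc σ d M → ℂ := fun n => φ n.1

/-- The matrix of the compression of `A` to the states with at most `M` particles. -/
noncomputable def trunc (M : ℕ) (A : FockOp σ d) : Matrix (LowOcc σ d M) (LowOcc σ d M) ℂ :=
  Matrix.of fun m n => matElem m.1 A n.1

lemma trunc_apply (M : ℕ) (A : FockOp σ d) (m n : LowOcc σ d M) :
    trunc M A m n = matElem m.1 A n.1 := rfl

lemma trunc_sum_smul {ι : Type*} (M : ℕ) (s : Finset ι) (c : ι → ℂ) (A : ι → FockOp σ d) :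
    trunc M (∑ l ∈ s, c l • A l) = ∑ l ∈ s, c l • trunc M (A l) := by
  ext m n
  simp [trunc_apply, matElem, Matrix.sum_apply]

lemma trunc_add (M : ℕ) (A B : FockOp σ d) : trunc M (A + B) = trunc M A + trunc M B := by
  ext m n
  simp [trunc_apply, matElem]

lemma trunc_one (M : ℕ) : trunc M (1 : FockOp σ d) = 1 := by
  ext m n
  rw [trunc_apply, matElem, Module.End.one_apply]
  by_cases h : m = n
  · subst h
    rw [ket_apply_self, Matrix.one_apply_eq]
  · rw [Matrix.one_apply_ne h, ket_apply_of_ne fun h' => h (Subtype.ext h'.symm)]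

lemma apply_eq_sum (A : FockOp σ d) (φ : FockV σ d) (m : Occ σ d) :
    A φ m = ∑ n ∈ φ.support, matElem m A n * φ n := by
  have h1 : φ = ∑ n ∈ φ.support, φ n • ket n := by
    conv_lhs => rw [← Finsupp.sum_single φ]
    simp [Finsupp.sum, ket]
  conv_lhs => rw [h1]
  simp [matElem, Finsupp.coe_finsetSum, mul_comm]

lemma apply_eq_sum_lowOcc {M : ℕ} {A : FockOp σ d} {φ : FockV σ d} {m : Occ σ d}
    (h : ∀ n, φ n ≠ 0 → matElem m A n ≠ 0 → n.total ≤ M) :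
    A φ m = ∑ n : LowOcc σ d M, matElem m A n.1 * φ n.1 := by
  classical
  rw [apply_eq_sum]
  have h1 : ∑ n : LowOcc σ d M, matElem m A n.1 * φ n.1 =
      ∑ n ∈ Finset.univ.map (Function.Embedding.subtype fun n : Occ σ d => n.total ≤ M),
        matElem m A n * φ n := by
    rw [Finset.sum_map]
    rfl
  rw [h1]
  refine Finset.sum_congr_of_eq_on_inter ?_ ?_ fun _ _ _ => rfl
  · intro n hn hn'
    by_contra hne
    refine hn' (Finset.mem_map.2 ⟨⟨n, h n (right_ne_zero_of_mul hne) (left_ne_zero_of_mul hne)⟩,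
      Finset.mem_univ _, rfl⟩)
  · intro n _ hn
    rw [Finsupp.notMem_support_iff.1 hn, mul_zero]

lemma truncVec_apply {M : ℕ} (A : FockOp σ d) {φ : FockV σ d} (hφ : IsLow M φ) :
    truncVec M (A φ) = (trunc M A).mulVec (truncVec M φ) :=
  funext fun _ => apply_eq_sum_lowOcc fun n hn _ => hφ n hn

/-- Compression is multiplicative only if no intermediate state has more than `M` particles; it is
enough that one of the factors conserves the number. -/
lemma trunc_mul_of_conserves_left (M : ℕ) {A : FockOp σ d} (hA : ConservesNumber A)
    (B : FockOp σ d) : trunc M (A * B) = trunc M A * trunc M B := by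
  ext m n
  refine apply_eq_sum_lowOcc (A := A) (φ := B (ket n.1)) (m := m.1) fun k _ hk => ?_
  by_contra h
  exact hk (hA.matElem_eq_zero fun h' => h (h' ▸ m.2))

lemma trunc_mul_of_conserves_right (M : ℕ) (A : FockOp σ d) {B : FockOp σ d}
    (hB : ConservesNumber B) : trunc M (A * B) = trunc M A * trunc M B := by
  ext m n
  refine apply_eq_sum_lowOcc (A := A) (φ := B (ket n.1)) (m := m.1) fun k hk _ => ?_
  by_contra h
  exact hk (hB.matElem_eq_zero fun h' => h (h' ▸ n.2))

lemma exists_of_apply_ne_zero {A : FockOp σ d} {φ : FockV σ d} {m : Occ σ d} (h : A φ m ≠ 0) :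
    ∃ n, φ n ≠ 0 ∧ matElem m A n ≠ 0 := by
  rw [apply_eq_sum] at h
  obtain ⟨n, -, hn⟩ := Finset.exists_ne_zero_of_sum_ne_zero h
  exact ⟨n, right_ne_zero_of_mul hn, left_ne_zero_of_mul hn⟩

lemma conservesNumber_of_matElem {A : FockOp σ d}
    (hA : ∀ m n : Occ σ d, m.total ≠ n.total → matElem m A n = 0) : ConservesNumber A := by
  intro N φ hφ
  rw [mem_nParticle] at hφ ⊢
  intro m hm
  obtain ⟨n, hn, hn'⟩ := exists_of_apply_ne_zero hm
  rw [← hφ n hn]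
  by_contra h
  exact hn' (hA m n h)

lemma isLow_ket (n : Occ σ d) : IsLow n.total (ket n) := fun m hm =>
  (mem_nParticle.1 (ket_mem_nParticle n) m hm).le

lemma IsLow.mono {M M' : ℕ} {φ : FockV σ d} (hφ : IsLow M φ) (h : M ≤ M') : IsLow M' φ :=
  fun n hn => (hφ n hn).trans h

lemma IsLow.conserves {M : ℕ} {φ : FockV σ d} (hφ : IsLow M φ) {A : FockOp σ d}
    (hA : ConservesNumber A) : IsLow M (A φ) := by
  intro m hm
  obtain ⟨n, hn, hn'⟩ := exists_of_apply_ne_zero hm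
  by_contra h
  exact hn' (hA.matElem_eq_zero fun h' => h (h' ▸ hφ n hn))

lemma ketOf_apply_ne_zero {n : Fin d → ℕ} {m : Occ σ d} (h : ketOf σ n m ≠ 0) : m.1 = n := by
  by_cases hn : σ = Statistics.fermion → ∀ i, n i ≤ 1
  · rw [show ketOf σ n = ket ⟨n, hn⟩ from dif_pos hn] at h
    by_contra h'
    exact h (ket_apply_of_ne fun h'' => h' (congrArg Subtype.val h''.symm))
  · rw [ketOf_of_not hn] at h
    exact absurd rfl h

lemma IsLow.creat {M : ℕ} {φ : FockV σ d} (hφ : IsLow M φ) (i : Fin d) :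
    IsLow (M + 1) (creat i φ) := by
  intro m hm
  obtain ⟨n, hn, hn'⟩ := exists_of_apply_ne_zero hm
  rw [matElem, ← ketOf_val, creat_ketOf, Finsupp.smul_apply] at hn'
  have h1 := ketOf_apply_ne_zero (right_ne_zero_of_smul hn')
  have h2 := Occ.total_update n.1 i (n.1 i + 1)
  have h3 := hφ n hn
  rw [Occ.total] at h3 ⊢
  rw [h1]
  omega

lemma IsLow.annih {M : ℕ} {φ : FockV σ d} (hφ : IsLow M φ) (i : Fin d) :
    IsLow M (annih i φ) := by
  intro m hm
  obtain ⟨n, hn, hn'⟩ := exists_of_apply_ne_zero hm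
  rw [matElem, annih_ket, Finsupp.smul_apply] at hn'
  have h1 := ketOf_apply_ne_zero (right_ne_zero_of_smul hn')
  have h2 := Occ.total_update n.1 i (n.1 i - 1)
  have h3 := hφ n hn
  rw [Occ.total] at h3 ⊢
  rw [h1]
  omega

/-! ### Matrix-valued functions -/

lemma memLp_top_of_eq_sum_smul {α E κ : Type*} [MeasurableSpace α] {μ : Measure α}
    [NormedAddCommGroup E] [NormedSpace ℂ E] (s : Finset κ) (f : κ → α → ℂ) (v : κ → E)
    (X : α → E) (hX : ∀ x, X x = ∑ k ∈ s, f k x • v k)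
    (hf : ∀ k ∈ s, MemLp (f k) ⊤ μ) : MemLp X ⊤ μ := by
  rw [show X = fun x => ∑ k ∈ s, f k x • v k from funext hX]
  refine memLp_finsetSum (f := fun k x => f k x • v k) _ fun k hk => ?_
  obtain ⟨C, hC0, hC⟩ := (hf k hk).exists_ae_bound
  refine memLp_top_of_bound ((hf k hk).1.smul_const _) (C * ‖v k‖) ?_
  filter_upwards [hC] with x hx
  rw [norm_smul]
  gcongr

section

attribute [local instance] Matrix.linftyOpNormedAddCommGroup Matrix.linftyOpNormedRing
  Matrix.linftyOpNormedAlgebra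

variable {ι : Type*} [Fintype ι] [DecidableEq ι]

lemma Matrix.eq_sum_smul_single (X : Matrix ι ι ℂ) :
    X = ∑ m, ∑ n, X m n • Matrix.single m n (1 : ℂ) := by
  conv_lhs => rw [Matrix.matrix_eq_sum_single X]
  simp

lemma continuousOn_matrix_of_entries {X : ℝ → Matrix ι ι ℂ} {S : Set ℝ}
    (h : ∀ m n, ContinuousOn (fun s => X s m n) S) : ContinuousOn X S := by
  have h1 : X = fun s => ∑ m, ∑ n, X s m n • Matrix.single m n (1 : ℂ) :=
    funext fun s => Matrix.eq_sum_smul_single _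
  rw [h1]
  exact continuousOn_finsetSum _ fun m _ => continuousOn_finsetSum _ fun n _ =>
    (h m n).smul continuousOn_const

lemma hasDerivAt_matrix_of_entries {X : ℝ → Matrix ι ι ℂ} {X' : Matrix ι ι ℂ} {s : ℝ}
    (h : ∀ m n, HasDerivAt (fun r => X r m n) (X' m n) s) : HasDerivAt X X' s := by
  have h1 : X = fun s => ∑ m, ∑ n, X s m n • Matrix.single m n (1 : ℂ) :=
    funext fun s => Matrix.eq_sum_smul_single _
  rw [h1, Matrix.eq_sum_smul_single X']
  exact HasDerivAt.fun_sum fun m _ => HasDerivAt.fun_sum fun n _ => (h m n).smul_const _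

lemma memLp_top_matrix_of_entries {α : Type*} [MeasurableSpace α] {μ : Measure α}
    {X : α → Matrix ι ι ℂ} (h : ∀ m n, MemLp (fun s => X s m n) ⊤ μ) : MemLp X ⊤ μ := by
  refine memLp_top_of_eq_sum_smul (Finset.univ : Finset (ι × ι)) (fun k x => X x k.1 k.2)
    (fun k => Matrix.single k.1 k.2 (1 : ℂ)) X ?_ fun k _ => h k.1 k.2
  intro x
  rw [Fintype.sum_prod_type]
  exact Matrix.eq_sum_smul_single (X x)

/-- A matrix entry as a continuous linear functional. -/
noncomputable def entryCLM (m n : ι) : Matrix ι ι ℂ →L[ℝ] ℂ :=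
  LinearMap.toContinuousLinearMap
    { toFun := fun X => X m n
      map_add' := fun _ _ => rfl
      map_smul' := fun _ _ => rfl }

omit [DecidableEq ι] in
lemma entryCLM_apply (m n : ι) (X : Matrix ι ι ℂ) : entryCLM m n X = X m n := rfl

/-! ### The evolution on the truncated spaces -/

variable {γ : ℝ → ℂ} {H : ℝ → FockOp σ d} {s₀ s₁ : ℝ} {U : ℝ → ℝ → FockOp σ d}

lemma IsEvolution.continuousOn_trunc (hU : IsEvolution γ H s₀ s₁ U) (M : ℕ) {s' : ℝ}
    (hs' : s' ∈ Icc s₀ s₁) : ContinuousOn (fun s => trunc M (U s s')) (Icc s₀ s₁) :=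
  continuousOn_matrix_of_entries fun m n => ((hU s' hs').2 m.1 n.1).1

lemma IsEvolution.hasDerivAt_trunc (hU : IsEvolution γ H s₀ s₁ U)
    (hH : ∀ s ∈ Ioo s₀ s₁, ConservesNumber (H s)) (M : ℕ) {s' : ℝ} (hs' : s' ∈ Icc s₀ s₁) :
    ∃ P : Set ℝ, P.Finite ∧ ∀ s ∈ Ioo s₀ s₁, s ∉ P → HasDerivAt (fun r => trunc M (U r s'))
      ((-Complex.I * deriv γ s) • trunc M (H s) * trunc M (U s s')) s := by
  choose P hP using fun m n : LowOcc σ d M => ((hU s' hs').2 m.1 n.1).2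
  refine ⟨⋃ m, ⋃ n, (P m n : Set ℝ),
    finite_iUnion fun m => finite_iUnion fun n => (P m n).finite_toSet, fun s hs hsP => ?_⟩
  refine hasDerivAt_matrix_of_entries fun m n => ?_
  simp only [mem_iUnion, not_exists] at hsP
  refine (hP m n s hs (hsP m n)).congr_deriv ?_
  rw [smul_mul_assoc, ← trunc_mul_of_conserves_left M (hH s hs)]
  rfl

lemma memLp_generator (hH : IsPiecewiseContinuousOp H s₀ s₁)
    (hγ : PiecewiseContinuousOn (deriv γ) s₀ s₁) (M : ℕ) :
    MemLp (fun s => (-Complex.I * deriv γ s) • trunc M (H s)) ⊤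
      (volume.restrict (Ioo s₀ s₁)) := by
  refine memLp_top_matrix_of_entries fun m n => ?_
  have h1 : MemLp (fun s => -Complex.I * deriv γ s) ⊤ (volume.restrict (Ioo s₀ s₁)) :=
    hγ.memLp_top.const_mul _
  exact (hH m.1 n.1).memLp_top.mul' h1

/-- `U` is the evolution operator of a number-conserving, piecewise continuous Hamiltonian along a
contour with piecewise continuous tangent. -/
structure IsRegularEvolution (γ : ℝ → ℂ) (H : ℝ → FockOp σ d) (s₀ s₁ : ℝ)
    (U : ℝ → ℝ → FockOp σ d) : Prop where
  evol : IsEvolution γ H s₀ s₁ U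
  conserves : ∀ s ∈ Ioo s₀ s₁, ConservesNumber (H s)
  cont : IsPiecewiseContinuousOp H s₀ s₁
  deriv_cont : PiecewiseContinuousOn (deriv γ) s₀ s₁
  lt : s₀ < s₁

namespace IsRegularEvolution

variable (hU : IsRegularEvolution γ H s₀ s₁ U)
include hU

lemma left_mem : s₀ ∈ Icc s₀ s₁ := left_mem_Icc.2 hU.lt.le

lemma right_mem : s₁ ∈ Icc s₀ s₁ := right_mem_Icc.2 hU.lt.le

lemma trunc_self (M : ℕ) {s : ℝ} (hs : s ∈ Icc s₀ s₁) : trunc M (U s s) = 1 := by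
  rw [(hU.evol s hs).1, trunc_one]

lemma trunc_eq_mul (M : ℕ) {s s' : ℝ} (hs : s ∈ Icc s₀ s₁) (hs' : s' ∈ Icc s₀ s₁) :
    trunc M (U s s') = trunc M (U s s₀) * trunc M (U s₀ s') := by
  obtain ⟨P, hP, hd⟩ := hU.evol.hasDerivAt_trunc hU.conserves M hs'
  obtain ⟨Q, hQ, hd'⟩ := hU.evol.hasDerivAt_trunc hU.conserves M hU.left_mem
  have h1 := eq_zero_of_linear_ode
    (y := fun s => trunc M (U s s') - trunc M (U s s₀) * trunc M (U s₀ s')) (hP.union hQ)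
    ((hU.evol.continuousOn_trunc M hs').sub
      ((hU.evol.continuousOn_trunc M hU.left_mem).mul continuousOn_const))
    (fun s hs hsP => by
      refine ((hd s hs fun h => hsP (Or.inl h)).sub
        ((hd' s hs fun h => hsP (Or.inr h)).mul_const _)).congr_deriv ?_
      rw [mul_sub, mul_assoc])
    (memLp_generator hU.cont hU.deriv_cont M)
    (by rw [hU.trunc_self M hU.left_mem, one_mul, sub_self]) s hs
  exact sub_eq_zero.1 h1

lemma trunc_mul_trunc_init (M : ℕ) {s : ℝ} (hs : s ∈ Icc s₀ s₁) :
    trunc M (U s s₀) * trunc M (U s₀ s) = 1 := by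
  rw [← hU.trunc_eq_mul M hs hs, hU.trunc_self M hs]

lemma isUnit_trunc (M : ℕ) {s : ℝ} (hs : s ∈ Icc s₀ s₁) : IsUnit (trunc M (U s s₀)) :=
  IsUnit.of_mul_eq_one _ (hU.trunc_mul_trunc_init M hs)

/-- The group property of the evolution, on the truncated spaces. -/
lemma trunc_eq_mul_inverse (M : ℕ) {s s' : ℝ} (hs : s ∈ Icc s₀ s₁) (hs' : s' ∈ Icc s₀ s₁) :
    trunc M (U s s') = trunc M (U s s₀) * Ring.inverse (trunc M (U s' s₀)) := by
  rw [hU.trunc_eq_mul M hs hs']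
  congr 1
  rw [← Ring.inverse_mul_cancel_left _ (trunc M (U s₀ s')) (hU.isUnit_trunc M hs'),
    hU.trunc_mul_trunc_init M hs', mul_one]

/-- The evolution conserves the particle number: the commutator with the number operator solves the
same linear equation, with vanishing initial value. -/
lemma evolution_conserves {s s' : ℝ} (hs : s ∈ Icc s₀ s₁) (hs' : s' ∈ Icc s₀ s₁) :
    ConservesNumber (U s s') := by
  refine conservesNumber_of_matElem fun m n hmn => ?_
  -- room for both states
  set M := max m.total n.total
  set D : Matrix (LowOcc σ d M) (LowOcc σ d M) ℂ := Matrix.diagonal fun k => (k.1.total : ℂ)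
  have hDH : ∀ s ∈ Ioo s₀ s₁, D * trunc M (H s) = trunc M (H s) * D := by
    intro s hs
    ext k l
    rw [Matrix.diagonal_mul, Matrix.mul_diagonal, trunc_apply]
    by_cases h : k.1.total = l.1.total
    · rw [h, mul_comm]
    · rw [(hU.conserves s hs).matElem_eq_zero h, mul_zero, zero_mul]
  have hDT : ∀ s ∈ Icc s₀ s₁, D * trunc M (U s s₀) = trunc M (U s s₀) * D := by
    obtain ⟨P, hP, hd⟩ := hU.evol.hasDerivAt_trunc hU.conserves M hU.left_mem
    have hc := hU.evol.continuousOn_trunc M hU.left_mem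
    intro s hs
    refine sub_eq_zero.1 (eq_zero_of_linear_ode
      (y := fun s => D * trunc M (U s s₀) - trunc M (U s s₀) * D) hP
      ((continuousOn_const.mul hc).sub (hc.mul continuousOn_const)) (fun s hs hsP => ?_)
      (memLp_generator hU.cont hU.deriv_cont M) ?_ s hs)
    · refine (((hd s hs hsP).const_mul D).sub ((hd s hs hsP).mul_const D)).congr_deriv ?_
      rw [mul_sub, ← mul_assoc, mul_smul_comm, hDH s hs, ← smul_mul_assoc]
      simp only [mul_assoc]
    · simp only [hU.trunc_self M hU.left_mem, mul_one, one_mul, sub_self]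
  have h1 : D * trunc M (U s s') = trunc M (U s s') * D := by
    rw [hU.trunc_eq_mul_inverse M hs hs', ← mul_assoc, hDT s hs, mul_assoc, mul_assoc]
    congr 1
    have hu := hU.isUnit_trunc M hs'
    calc D * Ring.inverse (trunc M (U s' s₀))
        = Ring.inverse (trunc M (U s' s₀)) * (trunc M (U s' s₀) * D) *
          Ring.inverse (trunc M (U s' s₀)) := by
            rw [Ring.inverse_mul_cancel_left _ _ hu]
      _ = Ring.inverse (trunc M (U s' s₀)) * D := by
            rw [← hDT s' hs', mul_assoc, Ring.mul_inverse_cancel_right _ _ hu]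
  have h2 := congrFun (congrFun h1 ⟨m, le_max_left _ _⟩) ⟨n, le_max_right _ _⟩
  rw [Matrix.diagonal_mul, Matrix.mul_diagonal, trunc_apply] at h2
  have h3 : ((m.total : ℂ) - n.total) * matElem m (U s s') n = 0 := by
    linear_combination h2
  refine (mul_eq_zero.1 h3).resolve_left (sub_ne_zero.2 ?_)
  exact_mod_cast hmn

end IsRegularEvolution

end

/-! ### Diagonal matrix elements of the time-ordered products -/

section

attribute [local instance] Matrix.linftyOpNormedAddCommGroup Matrix.linftyOpNormedRing
  Matrix.linftyOpNormedAlgebra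

variable {γ : ℝ → ℂ} {H : ℝ → FockOp σ d} {s₀ s₁ : ℝ} {U : ℝ → ℝ → FockOp σ d}

/-- `⟨n| U(s₁, s) a_i U(s, s') a_j† U(s', s₀) |n⟩`, for `x = (s, s')`. -/
noncomputable def greaterTerm (U : ℝ → ℝ → FockOp σ d) (s₀ s₁ : ℝ) (n : Occ σ d) (i j : Fin d)
    (x : ℝ × ℝ) : ℂ :=
  matElem n (U s₁ x.1 * annih i * U x.1 x.2 * creat j * U x.2 s₀) n

/-- `ζ ⟨n| U(s₁, s') a_j† U(s', s) a_i U(s, s₀) |n⟩`, for `x = (s, s')`. -/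
noncomputable def lesserTerm (U : ℝ → ℝ → FockOp σ d) (s₀ s₁ : ℝ) (n : Occ σ d) (i j : Fin d)
    (x : ℝ × ℝ) : ℂ :=
  σ.zeta * matElem n (U s₁ x.2 * creat j * U x.2 x.1 * annih i * U x.1 s₀) n

/-- The diagonal matrix element of the operator under the trace in the Green's function. -/
noncomputable def greenTerm (U : ℝ → ℝ → FockOp σ d) (s₀ s₁ : ℝ) (n : Occ σ d) (i j : Fin d)
    (x : ℝ × ℝ) : ℂ :=
  matElem n (greenOp U s₀ s₁ i j x.1 x.2) n

lemma greenTerm_of_lt {n : Occ σ d} {i j : Fin d} {x : ℝ × ℝ} (h : x.2 < x.1) :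
    greenTerm U s₀ s₁ n i j x = greaterTerm U s₀ s₁ n i j x := by
  rw [greenTerm, greenOp, if_pos h, greaterTerm]

lemma greenTerm_of_not_lt {n : Occ σ d} {i j : Fin d} {x : ℝ × ℝ} (h : ¬ x.2 < x.1) :
    greenTerm U s₀ s₁ n i j x = lesserTerm U s₀ s₁ n i j x := by
  rw [greenTerm, greenOp, if_neg h, lesserTerm]
  rfl

/-- The index of `n` in the space with room for one more particle. -/
def Occ.toLow (n : Occ σ d) : LowOcc σ d (n.total + 1) := ⟨n, Nat.le_succ _⟩

/-- The annihilation operator in the Heisenberg picture, truncated. -/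
noncomputable def annihH (U : ℝ → ℝ → FockOp σ d) (s₀ : ℝ) (M : ℕ) (i : Fin d) (s : ℝ) :
    Matrix (LowOcc σ d M) (LowOcc σ d M) ℂ :=
  heisenberg (fun r => trunc M (U r s₀)) (trunc M (annih i)) s

/-- The creation operator in the Heisenberg picture, truncated. -/
noncomputable def creatH (U : ℝ → ℝ → FockOp σ d) (s₀ : ℝ) (M : ℕ) (j : Fin d) (s : ℝ) :
    Matrix (LowOcc σ d M) (LowOcc σ d M) ℂ :=
  heisenberg (fun r => trunc M (U r s₀)) (trunc M (creat j)) s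

lemma truncVec_ket (n : Occ σ d) :
    truncVec (n.total + 1) (ket n) = Pi.single n.toLow (1 : ℂ) := by
  ext m
  by_cases h : m = n.toLow
  · subst h
    rw [Pi.single_eq_same, truncVec, Occ.toLow, ket_apply_self]
  · rw [Pi.single_eq_of_ne h, truncVec]
    exact ket_apply_of_ne fun h' => h (Subtype.ext h'.symm)

instance isFiniteMeasure_restrict_square (a b : ℝ) :
    IsFiniteMeasure ((volume : Measure (ℝ × ℝ)).restrict (Ioo a b ×ˢ Ioo a b)) := by
  rw [Measure.volume_eq_prod, ← Measure.prod_restrict]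
  infer_instance

namespace IsRegularEvolution

variable (hU : IsRegularEvolution γ H s₀ s₁ U)
include hU

lemma greaterTerm_eq (n : Occ σ d) (i j : Fin d) {s s' : ℝ} (hs : s ∈ Icc s₀ s₁)
    (hs' : s' ∈ Icc s₀ s₁) :
    greaterTerm U s₀ s₁ n i j (s, s') = (trunc (n.total + 1) (U s₁ s₀) *
      (annihH U s₀ (n.total + 1) i s * creatH U s₀ (n.total + 1) j s')) n.toLow n.toLow := by
  have c1 := hU.evolution_conserves hs' hU.left_mem
  have c2 := hU.evolution_conserves hs hs'
  have h1 : IsLow n.total (U s' s₀ (ket n)) := (isLow_ket n).conserves c1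
  have h1' : IsLow (n.total + 1) (U s' s₀ (ket n)) := h1.mono (Nat.le_succ _)
  have h1c : IsLow (n.total + 1) (creat j (U s' s₀ (ket n))) := h1.creat j
  have h2 := h1c.conserves c2
  have h0 : IsLow (n.total + 1) (ket n) := (isLow_ket n).mono (Nat.le_succ _)
  have h3 : greaterTerm U s₀ s₁ n i j (s, s') = truncVec (n.total + 1)
      (U s₁ s (annih i (U s s' (creat j (U s' s₀ (ket n)))))) n.toLow := rfl
  rw [h3, truncVec_apply _ (h2.annih i), truncVec_apply _ h2, truncVec_apply _ h1c,
    truncVec_apply _ h1', truncVec_apply _ h0, truncVec_ket]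
  simp only [Matrix.mulVec_mulVec]
  rw [Matrix.mulVec_single_one, Matrix.col_apply, hU.trunc_eq_mul_inverse _ hU.right_mem hs,
    hU.trunc_eq_mul_inverse _ hs hs', annihH, creatH,
    heisenberg, heisenberg]
  simp only [mul_assoc]

lemma lesserTerm_eq (n : Occ σ d) (i j : Fin d) {s s' : ℝ} (hs : s ∈ Icc s₀ s₁)
    (hs' : s' ∈ Icc s₀ s₁) :
    lesserTerm U s₀ s₁ n i j (s, s') = σ.zeta * (trunc (n.total + 1) (U s₁ s₀) *
      (creatH U s₀ (n.total + 1) j s' * annihH U s₀ (n.total + 1) i s)) n.toLow n.toLow := by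
  have c1 := hU.evolution_conserves hs hU.left_mem
  have c2 := hU.evolution_conserves hs' hs
  have h1 : IsLow n.total (U s s₀ (ket n)) := (isLow_ket n).conserves c1
  have h1' : IsLow (n.total + 1) (U s s₀ (ket n)) := h1.mono (Nat.le_succ _)
  have h2 : IsLow n.total (U s' s (annih i (U s s₀ (ket n)))) := (h1.annih i).conserves c2
  have h2' : IsLow (n.total + 1) (U s' s (annih i (U s s₀ (ket n)))) := h2.mono (Nat.le_succ _)
  have h2c : IsLow (n.total + 1) (creat j (U s' s (annih i (U s s₀ (ket n))))) := h2.creat j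
  have h0 : IsLow (n.total + 1) (ket n) := (isLow_ket n).mono (Nat.le_succ _)
  have h3 : lesserTerm U s₀ s₁ n i j (s, s') = σ.zeta * truncVec (n.total + 1)
      (U s₁ s' (creat j (U s' s (annih i (U s s₀ (ket n)))))) n.toLow := rfl
  rw [h3, truncVec_apply _ h2c, truncVec_apply _ h2', truncVec_apply _ (h1'.annih i),
    truncVec_apply _ h1', truncVec_apply _ h0, truncVec_ket]
  simp only [Matrix.mulVec_mulVec]
  rw [Matrix.mulVec_single_one, Matrix.col_apply, hU.trunc_eq_mul_inverse _ hU.right_mem hs',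
    hU.trunc_eq_mul_inverse _ hs' hs, annihH, creatH,
    heisenberg, heisenberg]
  simp only [mul_assoc]

lemma matElem_evolution_mul (n : Occ σ d) {s : ℝ} (hs : s ∈ Icc s₀ s₁) :
    matElem n (U s₁ s * U s s₀) n = matElem n (U s₁ s₀) n := by
  have h1 := trunc_mul_of_conserves_left n.total (hU.evolution_conserves hU.right_mem hs) (U s s₀)
  rw [hU.trunc_eq_mul_inverse _ hU.right_mem hs,
    Ring.inverse_mul_cancel_right _ _ (hU.isUnit_trunc _ hs)] at h1
  exact congrFun (congrFun h1 ⟨n, le_rfl⟩) ⟨n, le_rfl⟩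

/-- The jump of the time-ordered product at equal times comes from the canonical (anti)commutation
relations. -/
lemma greaterTerm_sub_lesserTerm (n : Occ σ d) (i j : Fin d) {s : ℝ} (hs : s ∈ Icc s₀ s₁) :
    greaterTerm U s₀ s₁ n i j (s, s) - lesserTerm U s₀ s₁ n i j (s, s) =
      (1 : Matrix (Fin d) (Fin d) ℂ) i j * matElem n (U s₁ s₀) n := by
  have h1 : (U s₁ s * annih i * U s s * creat j * U s s₀) =
      σ.zeta • (U s₁ s * creat j * U s s * annih i * U s s₀) +
        (1 : Matrix (Fin d) (Fin d) ℂ) i j • (U s₁ s * U s s₀) := by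
    rw [(hU.evol s hs).1, mul_one, mul_one, mul_assoc (U s₁ s) (annih i), annih_mul_creat, mul_add,
      add_mul, mul_smul_comm, mul_smul_comm, smul_mul_assoc, smul_mul_assoc, mul_one,
      ← mul_assoc (U s₁ s) (creat j)]
  rw [greaterTerm, lesserTerm, h1, ← hU.matElem_evolution_mul n hs]
  simp [matElem]

lemma continuousOn_annihH (M : ℕ) (i : Fin d) : ContinuousOn (annihH U s₀ M i) (Icc s₀ s₁) :=
  (hU.evol.continuousOn_trunc M hU.left_mem).heisenberg (fun _ hs => hU.isUnit_trunc M hs) _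

lemma continuousOn_creatH (M : ℕ) (j : Fin d) : ContinuousOn (creatH U s₀ M j) (Icc s₀ s₁) :=
  (hU.evol.continuousOn_trunc M hU.left_mem).heisenberg (fun _ hs => hU.isUnit_trunc M hs) _

lemma continuousOn_greaterTerm (n : Occ σ d) (i j : Fin d) :
    ContinuousOn (greaterTerm U s₀ s₁ n i j) (Icc s₀ s₁ ×ˢ Icc s₀ s₁) := by
  have h1 : ContinuousOn (fun x : ℝ × ℝ => annihH U s₀ (n.total + 1) i x.1)
      (Icc s₀ s₁ ×ˢ Icc s₀ s₁) :=
    (hU.continuousOn_annihH (n.total + 1) i).comp continuousOn_fst fun x hx => hx.1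
  have h2 : ContinuousOn (fun x : ℝ × ℝ => creatH U s₀ (n.total + 1) j x.2)
      (Icc s₀ s₁ ×ˢ Icc s₀ s₁) :=
    (hU.continuousOn_creatH (n.total + 1) j).comp continuousOn_snd fun x hx => hx.2
  refine ((entryCLM n.toLow n.toLow).continuous.comp_continuousOn
    ((continuousOn_const (c := trunc (n.total + 1) (U s₁ s₀))).mul (h1.mul h2))).congr
      fun x hx => ?_
  exact hU.greaterTerm_eq n i j hx.1 hx.2

lemma continuousOn_lesserTerm (n : Occ σ d) (i j : Fin d) :
    ContinuousOn (lesserTerm U s₀ s₁ n i j) (Icc s₀ s₁ ×ˢ Icc s₀ s₁) := by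
  have h1 : ContinuousOn (fun x : ℝ × ℝ => annihH U s₀ (n.total + 1) i x.1)
      (Icc s₀ s₁ ×ˢ Icc s₀ s₁) :=
    (hU.continuousOn_annihH (n.total + 1) i).comp continuousOn_fst fun x hx => hx.1
  have h2 : ContinuousOn (fun x : ℝ × ℝ => creatH U s₀ (n.total + 1) j x.2)
      (Icc s₀ s₁ ×ˢ Icc s₀ s₁) :=
    (hU.continuousOn_creatH (n.total + 1) j).comp continuousOn_snd fun x hx => hx.2
  refine ((continuousOn_const (c := σ.zeta)).mul
    ((entryCLM n.toLow n.toLow).continuous.comp_continuousOn ((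
      continuousOn_const (c := trunc (n.total + 1) (U s₁ s₀))).mul (h2.mul h1)))).congr
      fun x hx => ?_
  exact hU.lesserTerm_eq n i j hx.1 hx.2

lemma memLp_greenTerm (n : Occ σ d) (i j : Fin d) :
    MemLp (greenTerm U s₀ s₁ n i j) ⊤ (volume.restrict (Ioo s₀ s₁ ×ˢ Ioo s₀ s₁)) := by
  classical
  have hms : MeasurableSet {x : ℝ × ℝ | x.2 < x.1} := measurableSet_lt measurable_snd measurable_fst
  have key : ∀ {f : ℝ × ℝ → ℂ} {S : Set (ℝ × ℝ)}, ContinuousOn f (Icc s₀ s₁ ×ˢ Icc s₀ s₁) →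
      MemLp f ⊤ ((volume.restrict (Ioo s₀ s₁ ×ˢ Ioo s₀ s₁)).restrict S) := fun hf =>
    (hf.memLp_top (isCompact_Icc.prod isCompact_Icc) (measurableSet_Ioo.prod measurableSet_Ioo)
      (prod_mono Ioo_subset_Icc_self Ioo_subset_Icc_self)).restrict _
  have h1 := MemLp.piecewise hms (key (hU.continuousOn_greaterTerm n i j))
    (key (hU.continuousOn_lesserTerm n i j))
  refine (memLp_congr_ae (ae_of_all _ fun x => ?_)).1 h1
  by_cases h : x.2 < x.1
  · rw [piecewise_eq_of_mem _ _ _ (show x ∈ {x : ℝ × ℝ | x.2 < x.1} from h), greenTerm_of_lt h]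
  · rw [piecewise_eq_of_notMem _ _ _ (show x ∉ {x : ℝ × ℝ | x.2 < x.1} from h),
      greenTerm_of_not_lt h]

variable {p : ℕ} {h : ℝ → Matrix (Fin d) (Fin d) ℂ} (hH : IsImpurityHamiltonian p h H s₀ s₁)
include hH

lemma memLp_hopping {i l : Fin d} (hil : p ≤ (i : ℕ) ∨ p ≤ (l : ℕ)) :
    MemLp (fun s => h s i l) ⊤ (volume.restrict (Ioo s₀ s₁)) := by
  have h1 := (hU.cont (Occ.one σ i) (Occ.one σ l)).memLp_top.sub
    ((hU.cont (Occ.vac σ d) (Occ.vac σ d)).memLp_top.const_mul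
      ((1 : Matrix (Fin d) (Fin d) ℂ) i l))
  refine (memLp_congr_ae (ae_restrict_of_forall_mem measurableSet_Ioo fun s hs => ?_)).1 h1
  obtain ⟨hc, W, hW, hHW⟩ := hH s hs
  exact (hopping_eq_matElem hc hW hHW hil).symm

lemma memLp_weight_fst (c : ℂ) {i l : Fin d} (hil : p ≤ (i : ℕ) ∨ p ≤ (l : ℕ)) :
    MemLp (fun x : ℝ × ℝ => c * deriv γ x.1 * h x.1 i l) ⊤
      (volume.restrict (Ioo s₀ s₁ ×ˢ Ioo s₀ s₁)) := by
  have h1 : MemLp (fun s => c * deriv γ s * h s i l) ⊤ (volume.restrict (Ioo s₀ s₁)) :=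
    (hU.memLp_hopping hH hil).mul' (hU.deriv_cont.memLp_top.const_mul c)
  exact h1.top_comp_quasiMeasurePreserving (quasiMeasurePreserving_fst_Ioo s₀ s₁)

lemma memLp_weight_snd (c : ℂ) {i l : Fin d} (hil : p ≤ (i : ℕ) ∨ p ≤ (l : ℕ)) :
    MemLp (fun x : ℝ × ℝ => c * deriv γ x.2 * h x.2 i l) ⊤
      (volume.restrict (Ioo s₀ s₁ ×ˢ Ioo s₀ s₁)) := by
  have h1 : MemLp (fun s => c * deriv γ s * h s i l) ⊤ (volume.restrict (Ioo s₀ s₁)) :=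
    (hU.memLp_hopping hH hil).mul' (hU.deriv_cont.memLp_top.const_mul c)
  exact h1.top_comp_quasiMeasurePreserving (quasiMeasurePreserving_snd_Ioo s₀ s₁)

lemma hasDerivAt_annihH (M : ℕ) {i : Fin d} (hi : p ≤ (i : ℕ)) :
    ∃ P : Set ℝ, P.Finite ∧ ∀ s ∈ Ioo s₀ s₁, s ∉ P → HasDerivAt (annihH U s₀ M i)
      ((-Complex.I * deriv γ s) • ∑ l, h s i l • annihH U s₀ M l s) s := by
  obtain ⟨P, hP, hd⟩ := hU.evol.hasDerivAt_trunc hU.conserves M hU.left_mem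
  refine ⟨P, hP, fun s hs hsP => ?_⟩
  refine ((hd s hs hsP).heisenberg (hU.isUnit_trunc M (Ioo_subset_Icc_self hs)) _).congr_deriv ?_
  obtain ⟨hc, W, hW, hHW⟩ := hH s hs
  have h1 := congrArg (trunc M) (annih_mul_hamiltonian hc hW hHW hi)
  rw [trunc_mul_of_conserves_right _ _ hc, trunc_add, trunc_mul_of_conserves_left _ hc,
    trunc_sum_smul] at h1
  rw [mul_smul_comm, smul_mul_assoc, ← smul_sub, h1, add_sub_cancel_left, mul_smul_comm,
    smul_mul_assoc, Finset.mul_sum, Finset.sum_mul]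
  simp only [mul_smul_comm, smul_mul_assoc, annihH, heisenberg]

lemma hasDerivAt_creatH (M : ℕ) {j : Fin d} (hj : p ≤ (j : ℕ)) :
    ∃ P : Set ℝ, P.Finite ∧ ∀ s ∈ Ioo s₀ s₁, s ∉ P → HasDerivAt (creatH U s₀ M j)
      ((Complex.I * deriv γ s) • ∑ l, h s l j • creatH U s₀ M l s) s := by
  obtain ⟨P, hP, hd⟩ := hU.evol.hasDerivAt_trunc hU.conserves M hU.left_mem
  refine ⟨P, hP, fun s hs hsP => ?_⟩
  refine ((hd s hs hsP).heisenberg (hU.isUnit_trunc M (Ioo_subset_Icc_self hs)) _).congr_deriv ?_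
  obtain ⟨hc, W, hW, hHW⟩ := hH s hs
  have h1 := congrArg (trunc M) (hamiltonian_mul_creat hc hW hHW hj)
  rw [trunc_mul_of_conserves_left _ hc, trunc_add, trunc_mul_of_conserves_right _ _ hc,
    trunc_sum_smul] at h1
  rw [mul_smul_comm, smul_mul_assoc, ← smul_sub, h1, sub_add_cancel_left, smul_neg, ← neg_smul,
    neg_mul, neg_neg, mul_smul_comm, smul_mul_assoc, Finset.mul_sum, Finset.sum_mul]
  simp only [mul_smul_comm, smul_mul_assoc, creatH, heisenberg]

/-- The equation of motion of a single diagonal matrix element, in the first time argument. -/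
lemma integral_greenTerm_mul_fderiv_fst (n : Occ σ d) {i : Fin d} (j : Fin d) (hi : p ≤ (i : ℕ))
    {φ : ℝ × ℝ → ℂ} (hφ : IsTestFunction s₀ s₁ φ) :
    (∫ x in Ioo s₀ s₁ ×ˢ Ioo s₀ s₁, greenTerm U s₀ s₁ n i j x * fderiv ℝ φ x (1, 0)) +
      ∫ x in Ioo s₀ s₁ ×ˢ Ioo s₀ s₁,
        (∑ l, -Complex.I * deriv γ x.1 * h x.1 i l * greenTerm U s₀ s₁ n l j x) * φ x =
      -((1 : Matrix (Fin d) (Fin d) ℂ) i j * matElem n (U s₁ s₀) n) *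
        ∫ s in Ioo s₀ s₁, φ (s, s) := by
  obtain ⟨P, hP, hd⟩ := hU.hasDerivAt_annihH hH (n.total + 1) hi
  refine integral_mul_fderiv_fst hP.countable
    (fr := greaterTerm U s₀ s₁ n i j) (fl := lesserTerm U s₀ s₁ n i j)
    (kr := fun x => ∑ l, -Complex.I * deriv γ x.1 * h x.1 i l * greaterTerm U s₀ s₁ n l j x)
    (kl := fun x => ∑ l, -Complex.I * deriv γ x.1 * h x.1 i l * lesserTerm U s₀ s₁ n l j x)
    (hU.continuousOn_greaterTerm n i j) (hU.continuousOn_lesserTerm n i j) ?_ ?_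
    (fun s _ t _ hst => greenTerm_of_lt hst) (fun s _ t _ hst => greenTerm_of_not_lt hst.not_gt)
    (fun s _ t _ hst => Finset.sum_congr rfl fun l _ => by rw [greenTerm_of_lt hst])
    (fun s _ t _ hst => Finset.sum_congr rfl fun l _ => by rw [greenTerm_of_not_lt hst.not_gt])
    (fun t ht => hU.greaterTerm_sub_lesserTerm n i j (Ioo_subset_Icc_self ht))
    ?_ ?_ hφ
  · intro s hs hsP t ht
    have h1 := (entryCLM n.toLow n.toLow).hasFDerivAt.comp_hasDerivAt s
      ((((hd s hs hsP).mul_const (creatH U s₀ (n.total + 1) j t))).const_mul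
        (trunc (n.total + 1) (U s₁ s₀)))
    have h2 : (fun r => greaterTerm U s₀ s₁ n i j (r, t)) =ᶠ[𝓝 s] _ :=
      eventually_of_mem (Ioo_mem_nhds hs.1 hs.2) fun r hr =>
        hU.greaterTerm_eq n i j (Ioo_subset_Icc_self hr) (Ioo_subset_Icc_self ht)
    refine (h1.congr_of_eventuallyEq h2).congr_deriv ?_
    simp only [hU.greaterTerm_eq n _ j (Ioo_subset_Icc_self hs) (Ioo_subset_Icc_self ht)]
    refine (entryCLM_apply _ _ _).trans ?_
    simp only [smul_mul_assoc, mul_smul_comm, Finset.sum_mul, Finset.mul_sum, Finset.smul_sum,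
      Matrix.sum_apply, Matrix.smul_apply, smul_eq_mul, mul_assoc]
  · intro s hs hsP t ht
    have h1 := ((entryCLM n.toLow n.toLow).hasFDerivAt.comp_hasDerivAt s
      ((((hd s hs hsP).const_mul (creatH U s₀ (n.total + 1) j t))).const_mul
        (trunc (n.total + 1) (U s₁ s₀)))).const_mul σ.zeta
    have h2 : (fun r => lesserTerm U s₀ s₁ n i j (r, t)) =ᶠ[𝓝 s] _ :=
      eventually_of_mem (Ioo_mem_nhds hs.1 hs.2) fun r hr =>
        hU.lesserTerm_eq n i j (Ioo_subset_Icc_self hr) (Ioo_subset_Icc_self ht)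
    refine (h1.congr_of_eventuallyEq h2).congr_deriv ?_
    simp only [hU.lesserTerm_eq n _ j (Ioo_subset_Icc_self hs) (Ioo_subset_Icc_self ht)]
    refine (congrArg (σ.zeta * ·) (entryCLM_apply _ _ _)).trans ?_
    simp only [mul_smul_comm, Finset.mul_sum, Finset.smul_sum, Matrix.sum_apply,
      Matrix.smul_apply, smul_eq_mul]
    exact Finset.sum_congr rfl fun l _ => by ring
  · exact (hU.memLp_greenTerm n i j).integrable le_top
  · refine integrable_finsetSum _ fun l _ => MemLp.integrable (q := ⊤) le_top ?_
    exact (hU.memLp_greenTerm n l j).mul' (hU.memLp_weight_fst hH (-Complex.I) (l := l) (Or.inl hi))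

/-- The equation of motion of a single diagonal matrix element, in the second time argument. -/
lemma integral_greenTerm_mul_fderiv_snd (n : Occ σ d) (i : Fin d) {j : Fin d} (hj : p ≤ (j : ℕ))
    {φ : ℝ × ℝ → ℂ} (hφ : IsTestFunction s₀ s₁ φ) :
    (∫ x in Ioo s₀ s₁ ×ˢ Ioo s₀ s₁, greenTerm U s₀ s₁ n i j x * fderiv ℝ φ x (0, 1)) +
      ∫ x in Ioo s₀ s₁ ×ˢ Ioo s₀ s₁,
        (∑ l, Complex.I * deriv γ x.2 * h x.2 l j * greenTerm U s₀ s₁ n i l x) * φ x =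
      (1 : Matrix (Fin d) (Fin d) ℂ) i j * matElem n (U s₁ s₀) n *
        ∫ s in Ioo s₀ s₁, φ (s, s) := by
  obtain ⟨P, hP, hd⟩ := hU.hasDerivAt_creatH hH (n.total + 1) hj
  refine integral_mul_fderiv_snd hP.countable
    (fr := greaterTerm U s₀ s₁ n i j) (fl := lesserTerm U s₀ s₁ n i j)
    (kr := fun x => ∑ l, Complex.I * deriv γ x.2 * h x.2 l j * greaterTerm U s₀ s₁ n i l x)
    (kl := fun x => ∑ l, Complex.I * deriv γ x.2 * h x.2 l j * lesserTerm U s₀ s₁ n i l x)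
    (hU.continuousOn_greaterTerm n i j) (hU.continuousOn_lesserTerm n i j) ?_ ?_
    (fun s _ t _ hst => greenTerm_of_lt hst) (fun s _ t _ hst => greenTerm_of_not_lt hst.not_gt)
    (fun s _ t _ hst => Finset.sum_congr rfl fun l _ => by rw [greenTerm_of_lt hst])
    (fun s _ t _ hst => Finset.sum_congr rfl fun l _ => by rw [greenTerm_of_not_lt hst.not_gt])
    (fun t ht => hU.greaterTerm_sub_lesserTerm n i j (Ioo_subset_Icc_self ht))
    ?_ ?_ hφ
  · intro t ht htP s hs
    have h1 := (entryCLM n.toLow n.toLow).hasFDerivAt.comp_hasDerivAt t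
      ((((hd t ht htP).const_mul (annihH U s₀ (n.total + 1) i s))).const_mul
        (trunc (n.total + 1) (U s₁ s₀)))
    have h2 : (fun r => greaterTerm U s₀ s₁ n i j (s, r)) =ᶠ[𝓝 t] _ :=
      eventually_of_mem (Ioo_mem_nhds ht.1 ht.2) fun r hr =>
        hU.greaterTerm_eq n i j (Ioo_subset_Icc_self hs) (Ioo_subset_Icc_self hr)
    refine (h1.congr_of_eventuallyEq h2).congr_deriv ?_
    simp only [hU.greaterTerm_eq n i _ (Ioo_subset_Icc_self hs) (Ioo_subset_Icc_self ht)]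
    refine (entryCLM_apply _ _ _).trans ?_
    simp only [mul_smul_comm, Finset.mul_sum, Finset.smul_sum, Matrix.sum_apply,
      Matrix.smul_apply, smul_eq_mul, mul_assoc]
  · intro t ht htP s hs
    have h1 := ((entryCLM n.toLow n.toLow).hasFDerivAt.comp_hasDerivAt t
      ((((hd t ht htP).mul_const (annihH U s₀ (n.total + 1) i s))).const_mul
        (trunc (n.total + 1) (U s₁ s₀)))).const_mul σ.zeta
    have h2 : (fun r => lesserTerm U s₀ s₁ n i j (s, r)) =ᶠ[𝓝 t] _ :=
      eventually_of_mem (Ioo_mem_nhds ht.1 ht.2) fun r hr =>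
        hU.lesserTerm_eq n i j (Ioo_subset_Icc_self hs) (Ioo_subset_Icc_self hr)
    refine (h1.congr_of_eventuallyEq h2).congr_deriv ?_
    simp only [hU.lesserTerm_eq n i _ (Ioo_subset_Icc_self hs) (Ioo_subset_Icc_self ht)]
    refine (congrArg (σ.zeta * ·) (entryCLM_apply _ _ _)).trans ?_
    simp only [smul_mul_assoc, mul_smul_comm, Finset.sum_mul, Finset.mul_sum, Finset.smul_sum,
      Matrix.sum_apply, Matrix.smul_apply, smul_eq_mul]
    exact Finset.sum_congr rfl fun l _ => by ring
  · exact (hU.memLp_greenTerm n i j).integrable le_top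
  · refine integrable_finsetSum _ fun l _ => MemLp.integrable (q := ⊤) le_top ?_
    exact (hU.memLp_greenTerm n i l).mul' (hU.memLp_weight_snd hH Complex.I (i := l) (Or.inr hj))

end IsRegularEvolution

end

/-! ### Termwise integration of the trace -/

section

variable {ι X : Type*} [Countable ι] [MeasurableSpace X] {μ : Measure X} {g : ι → X → ℂ}

lemma integrable_tsum_of_lintegral_tsum_enorm (hg : ∀ n, AEStronglyMeasurable (g n) μ)
    (hfin : ∫⁻ x, ∑' n, ‖g n x‖ₑ ∂μ < ⊤) : Integrable (fun x => ∑' n, g n x) μ :=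
  ⟨(AEMeasurable.tsum fun n => (hg n).aemeasurable).aestronglyMeasurable,
    (lintegral_mono fun _ => enorm_tsum_le_tsum_enorm).trans_lt hfin⟩

/-- Termwise integration against a bounded weight that is supported in a set where the absolute
series is integrable. -/
lemma hasSum_setIntegral_mul {S K : Set X} (hS : MeasurableSet S)
    (hKS : K ⊆ S) {ψ : X → ℂ} (hg : ∀ n, AEStronglyMeasurable (g n) (μ.restrict S))
    (hfin : ∫⁻ x in K, ∑' n, ‖g n x‖ₑ ∂μ < ⊤) (hψ : MemLp ψ ⊤ (μ.restrict S))
    (h0 : ∀ x ∉ K, ψ x = 0) :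
    IntegrableOn (fun x => (∑' n, g n x) * ψ x) S μ ∧
      HasSum (fun n => ∫ x in S, g n x * ψ x ∂μ) (∫ x in S, (∑' n, g n x) * ψ x ∂μ) := by
  have hgK : ∀ n, AEStronglyMeasurable (g n) (μ.restrict K) := fun n =>
    (hg n).mono_measure (Measure.restrict_mono hKS le_rfl)
  have hψK : MemLp ψ ⊤ (μ.restrict K) := hψ.mono_measure (Measure.restrict_mono hKS le_rfl)
  refine ⟨IntegrableOn.of_forall_sdiff_eq_zero (s := K)
    ((integrable_tsum_of_lintegral_tsum_enorm hgK hfin).mul_of_top_left hψK) hS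
    fun x hx => by rw [h0 x hx.2, mul_zero], ?_⟩
  have hres : ∀ f : X → ℂ, ∫ x in S, f x * ψ x ∂μ = ∫ x in K, f x * ψ x ∂μ := fun f =>
    setIntegral_eq_of_subset_of_forall_sdiff_eq_zero hS hKS fun x hx => by rw [h0 x hx.2, mul_zero]
  simp only [hres]
  simp only [← tsum_mul_right]
  have hsum : ∑' n, ∫⁻ x in K, ‖g n x‖ₑ ∂μ ≠ ⊤ := by
    rw [← lintegral_tsum fun n => (hgK n).enorm]
    exact hfin.ne
  have hgi : ∀ n, IntegrableOn (g n) K μ := fun n =>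
    ⟨hgK n, (ENNReal.ne_top_of_tsum_ne_top hsum n).lt_top⟩
  obtain ⟨C, hC0, hC⟩ := hψK.exists_ae_bound
  refine hasSum_integral_of_summable_integral_norm (F := fun n x => g n x * ψ x)
    (fun n => (hgi n).mul_of_top_left hψK) ?_
  have h1 : Summable fun n => C * ∫ x in K, ‖g n x‖ ∂μ := by
    refine Summable.mul_left C ?_
    simp only [integral_norm_eq_lintegral_enorm (hgK _)]
    exact ENNReal.summable_toReal hsum
  refine h1.of_nonneg_of_le (fun n => integral_nonneg fun _ => norm_nonneg _) fun n => ?_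
  rw [← integral_const_mul]
  refine integral_mono_ae ((hgi n).mul_of_top_left hψK).norm ((hgi n).norm.const_mul C) ?_
  filter_upwards [hC] with x hx
  simp only [norm_mul]
  rw [mul_comm]
  gcongr

end

/-! ### Equations of motion of the Green's function -/

section

variable {γ : ℝ → ℂ} {H : ℝ → FockOp σ d} {s₀ s₁ : ℝ} {U : ℝ → ℝ → FockOp σ d}

lemma locallyIntegrableOn_weighted_sum {f : Fin d → ℝ × ℝ → ℂ} {w : Fin d → ℝ × ℝ → ℂ}
    (hf : ∀ l, LocallyIntegrableOn (f l) (Ioo s₀ s₁ ×ˢ Ioo s₀ s₁))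
    (hw : ∀ l, MemLp (w l) ⊤ (volume.restrict (Ioo s₀ s₁ ×ˢ Ioo s₀ s₁))) :
    LocallyIntegrableOn (fun x => ∑ l, w l x * f l x) (Ioo s₀ s₁ ×ˢ Ioo s₀ s₁) := by
  refine (locallyIntegrableOn_iff (isOpen_Ioo.prod isOpen_Ioo).isLocallyClosed).2
    fun K hKI hK => integrable_finsetSum _ fun l _ => ?_
  exact Integrable.mul_of_top_right ((hf l).integrableOn_compact_subset hKI hK)
    ((hw l).mono_measure (Measure.restrict_mono hKI le_rfl))

lemma Continuous.memLp_top_square {ψ : ℝ × ℝ → ℂ} (hψ : Continuous ψ) :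
    MemLp ψ ⊤ (volume.restrict (Ioo s₀ s₁ ×ˢ Ioo s₀ s₁)) :=
  hψ.continuousOn.memLp_top (isCompact_Icc.prod isCompact_Icc)
    (measurableSet_Ioo.prod measurableSet_Ioo)
    (prod_mono (Ioo_subset_Icc_self (a := s₀) (b := s₁)) Ioo_subset_Icc_self)

instance Occ.finite_fermion : Finite (Occ Statistics.fermion d) := by
  refine Finite.of_injective (fun n : Occ Statistics.fermion d => fun i : Fin d =>
    (⟨n.1 i, Nat.lt_succ_of_le (n.2 rfl i)⟩ : Fin 2)) fun m n h => Subtype.ext (funext fun i => ?_)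
  exact congrArg Fin.val (congrFun h i)

lemma green_eq (i j : Fin d) (x : ℝ × ℝ) : green U s₀ s₁ i j x.1 x.2 =
    -Complex.I / partitionFn U s₀ s₁ * ∑' n, greenTerm U s₀ s₁ n i j x := rfl

lemma hasSum_partitionFn (hZ : partitionFn U s₀ s₁ ≠ 0) :
    HasSum (fun n => matElem n (U s₁ s₀) n) (partitionFn U s₀ s₁) := by
  refine Summable.hasSum ?_
  by_contra h
  exact hZ (tsum_eq_zero_of_not_summable h)

namespace IsRegularEvolution

variable (hU : IsRegularEvolution γ H s₀ s₁ U)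
include hU

/-- For fermions, there are finitely many states, so the traces are finite sums of bounded
functions. -/
lemma hasLocallyIntegrableTraces_of_fermion (hσ : σ = Statistics.fermion) :
    HasLocallyIntegrableTraces U s₀ s₁ := by
  subst hσ
  intro i j K _ hKI
  have := Fintype.ofFinite (Occ Statistics.fermion d)
  simp only [tsum_fintype]
  have hi : ∀ n, IntegrableOn (greenTerm U s₀ s₁ n i j) K volume := fun n =>
    ((hU.memLp_greenTerm n i j).integrable le_top).mono_measure (Measure.restrict_mono hKI le_rfl)
  change ∫⁻ x in K, ∑ n, ‖greenTerm U s₀ s₁ n i j x‖ₑ < ⊤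
  rw [lintegral_finsetSum' _ fun n _ => (hi n).1.enorm]
  exact ENNReal.sum_lt_top.2 fun n _ => (hi n).2

variable (hG : HasLocallyIntegrableTraces U s₀ s₁)
include hG

lemma locallyIntegrableOn_green (i j : Fin d) :
    LocallyIntegrableOn (fun x : ℝ × ℝ => green U s₀ s₁ i j x.1 x.2)
      (Ioo s₀ s₁ ×ˢ Ioo s₀ s₁) := by
  refine (locallyIntegrableOn_iff (isOpen_Ioo.prod isOpen_Ioo).isLocallyClosed).2
    fun K hKI hK => ?_
  simp only [green_eq]
  exact (integrable_tsum_of_lintegral_tsum_enorm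
    (fun n => (hU.memLp_greenTerm n i j).1.mono_measure (Measure.restrict_mono hKI le_rfl))
    (hG i j K hK hKI)).const_mul _

/-- Termwise integration of the trace against a bounded weight supported in that of a test
function. -/
lemma hasSum_integral_greenTerm_mul (i j : Fin d) {φ ψ : ℝ × ℝ → ℂ} (hφ : IsTestFunction s₀ s₁ φ)
    (hψ : MemLp ψ ⊤ (volume.restrict (Ioo s₀ s₁ ×ˢ Ioo s₀ s₁)))
    (h0 : ∀ x ∉ tsupport φ, ψ x = 0) :
    IntegrableOn (fun x => (∑' n, greenTerm U s₀ s₁ n i j x) * ψ x) (Ioo s₀ s₁ ×ˢ Ioo s₀ s₁) ∧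
      HasSum (fun n => ∫ x in Ioo s₀ s₁ ×ˢ Ioo s₀ s₁, greenTerm U s₀ s₁ n i j x * ψ x)
        (∫ x in Ioo s₀ s₁ ×ˢ Ioo s₀ s₁, (∑' n, greenTerm U s₀ s₁ n i j x) * ψ x) :=
  hasSum_setIntegral_mul (measurableSet_Ioo.prod measurableSet_Ioo)
    hφ.2.2 (fun n => (hU.memLp_greenTerm n i j).1)
    (hG i j _ hφ.2.1 hφ.2.2) hψ h0

/-- Summation over `n` of equations of motion for the diagonal matrix elements. Here `v` is the
direction of differentiation, `w` the coefficients, and `κ = ∓ δ_ij` the strength of the jump. -/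
lemma sum_equation_of_motion (hZ : partitionFn U s₀ s₁ ≠ 0) {φ : ℝ × ℝ → ℂ}
    (hφ : IsTestFunction s₀ s₁ φ) (v : ℝ × ℝ) (κ : ℂ) (i j : Fin d) (e : Fin d → Fin d × Fin d)
    (w : Fin d → ℝ × ℝ → ℂ)
    (hw : ∀ l, MemLp (w l) ⊤ (volume.restrict (Ioo s₀ s₁ ×ˢ Ioo s₀ s₁)))
    (heq : ∀ n, (∫ x in Ioo s₀ s₁ ×ˢ Ioo s₀ s₁, greenTerm U s₀ s₁ n i j x * fderiv ℝ φ x v) +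
      ∫ x in Ioo s₀ s₁ ×ˢ Ioo s₀ s₁,
        (∑ l, w l x * greenTerm U s₀ s₁ n (e l).1 (e l).2 x) * φ x =
      κ * matElem n (U s₁ s₀) n * ∫ s in Ioo s₀ s₁, φ (s, s)) :
    (∫ x in Ioo s₀ s₁ ×ˢ Ioo s₀ s₁, green U s₀ s₁ i j x.1 x.2 * fderiv ℝ φ x v) +
      ∫ x in Ioo s₀ s₁ ×ˢ Ioo s₀ s₁,
        (∑ l, w l x * green U s₀ s₁ (e l).1 (e l).2 x.1 x.2) * φ x =
      -Complex.I * κ * ∫ s in Ioo s₀ s₁, φ (s, s) := by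
  set S := Ioo s₀ s₁ ×ˢ Ioo s₀ s₁ with hS
  set Z := partitionFn U s₀ s₁ with hZdef
  have h1 := (hU.hasSum_integral_greenTerm_mul hG i j hφ
    (ψ := fun x => fderiv ℝ φ x v) ((hφ.continuous_fderiv v).memLp_top_square)
    fun x hx => by
      have h2 : fderiv ℝ φ x = 0 := by
        by_contra h3
        exact hx (support_fderiv_subset ℝ h3)
      rw [h2]
      rfl).2
  have hwφ : ∀ l, MemLp (fun x => w l x * φ x) ⊤ (volume.restrict S) := fun l =>
    hφ.1.continuous.memLp_top_square.mul' (hw l)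
  have hφ0 : ∀ l, ∀ x ∉ tsupport φ, w l x * φ x = 0 := fun l x hx => by
    rw [image_eq_zero_of_notMem_tsupport hx, mul_zero]
  have h2 := fun l => hU.hasSum_integral_greenTerm_mul hG (e l).1 (e l).2 hφ (hwφ l) (hφ0 l)
  have h3 := h1.add (hasSum_sum (s := Finset.univ) fun l _ => (h2 l).2)
  have h4 : ∀ n, (∑ l, ∫ x in S, greenTerm U s₀ s₁ n (e l).1 (e l).2 x * (w l x * φ x)) =
      ∫ x in S, (∑ l, w l x * greenTerm U s₀ s₁ n (e l).1 (e l).2 x) * φ x := by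
    intro n
    refine (integral_finsetSum _ fun l _ => ((hU.memLp_greenTerm n (e l).1 (e l).2).integrable
      le_top).mul_of_top_left (hwφ l)).symm.trans ?_
    refine integral_congr_ae (ae_of_all _ fun x => ?_)
    simp only [Finset.sum_mul, Pi.mul_apply]
    exact Finset.sum_congr rfl fun l _ => by ring
  have h5 : HasSum (fun n => κ * matElem n (U s₁ s₀) n * ∫ s in Ioo s₀ s₁, φ (s, s))
      (κ * Z * ∫ s in Ioo s₀ s₁, φ (s, s)) :=
    ((hasSum_partitionFn hZ).mul_left κ).mul_right _
  simp only [← hS, h4, heq] at h3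
  have h6 := h3.unique h5
  rw [← integral_finsetSum _ fun l _ => (h2 l).1] at h6
  have h7 : ∫ x in S, green U s₀ s₁ i j x.1 x.2 * fderiv ℝ φ x v =
      -Complex.I / Z * ∫ x in S, (∑' n, greenTerm U s₀ s₁ n i j x) * fderiv ℝ φ x v := by
    rw [← integral_const_mul]
    simp only [green_eq, mul_assoc, ← hZdef]
  have h8 : ∫ x in S, (∑ l, w l x * green U s₀ s₁ (e l).1 (e l).2 x.1 x.2) * φ x =
      -Complex.I / Z * ∫ x in S,
        ∑ l, (∑' n, greenTerm U s₀ s₁ n (e l).1 (e l).2 x) * (w l x * φ x) := by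
    rw [← integral_const_mul]
    refine integral_congr_ae (ae_of_all _ fun x => ?_)
    simp only [green_eq, Finset.sum_mul, Finset.mul_sum, ← hZdef]
    exact Finset.sum_congr rfl fun l _ => by ring
  rw [h7, h8, ← mul_add, h6]
  field_simp

variable {p : ℕ} {h : ℝ → Matrix (Fin d) (Fin d) ℂ} (hH : IsImpurityHamiltonian p h H s₀ s₁)
include hH

lemma locallyIntegrableOn_hGKernel {i : Fin d}
    (j : Fin d) (hi : p ≤ (i : ℕ)) :
    LocallyIntegrableOn (hGKernel γ h U s₀ s₁ i j) (Ioo s₀ s₁ ×ˢ Ioo s₀ s₁) := by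
  have h1 := locallyIntegrableOn_weighted_sum (fun l => hU.locallyIntegrableOn_green hG l j)
    fun l => hU.memLp_weight_fst hH 1 (i := i) (l := l) (Or.inl hi)
  simp only [one_mul, mul_assoc, ← Finset.mul_sum] at h1
  exact h1

lemma locallyIntegrableOn_GhKernel (i : Fin d) {j : Fin d} (hj : p ≤ (j : ℕ)) :
    LocallyIntegrableOn (GhKernel γ h U s₀ s₁ i j) (Ioo s₀ s₁ ×ˢ Ioo s₀ s₁) := by
  have h1 := locallyIntegrableOn_weighted_sum (fun l => hU.locallyIntegrableOn_green hG i l)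
    fun l => hU.memLp_weight_snd hH 1 (i := l) (l := j) (Or.inr hj)
  have h2 : GhKernel γ h U s₀ s₁ i j = fun x => ∑ l, 1 * deriv γ x.2 * h x.2 l j *
      green U s₀ s₁ i l x.1 x.2 := by
    funext x
    rw [GhKernel, Finset.mul_sum]
    exact Finset.sum_congr rfl fun l _ => by ring
  rw [h2]
  exact h1

/-- The equation of motion in the first argument, in the rows outside of the fragment. -/
theorem leftMotion_eq (hZ : partitionFn U s₀ s₁ ≠ 0) {i : Fin d} (j : Fin d) (hi : p ≤ (i : ℕ))
    {φ : ℝ × ℝ → ℂ} (hφ : IsTestFunction s₀ s₁ φ) :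
    leftMotion γ h U s₀ s₁ i j φ =
      (1 : Matrix (Fin d) (Fin d) ℂ) i j * contourDelta s₀ s₁ φ := by
  have h1 := hU.sum_equation_of_motion hG hZ hφ (1, 0) (-(1 : Matrix (Fin d) (Fin d) ℂ) i j) i j
    (fun l => (l, j)) (fun l x => -Complex.I * deriv γ x.1 * h x.1 i l)
    (fun l => hU.memLp_weight_fst hH (-Complex.I) (Or.inl hi))
    (fun n => (hU.integral_greenTerm_mul_fderiv_fst hH n j hi hφ).trans (by ring))
  have h2 : ∫ x in Ioo s₀ s₁ ×ˢ Ioo s₀ s₁,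
      (∑ l, -Complex.I * deriv γ x.1 * h x.1 i l * green U s₀ s₁ l j x.1 x.2) * φ x =
      -Complex.I * ∫ x in Ioo s₀ s₁ ×ˢ Ioo s₀ s₁, hGKernel γ h U s₀ s₁ i j x * φ x := by
    rw [← integral_const_mul]
    refine integral_congr_ae (ae_of_all _ fun x => ?_)
    simp only [hGKernel, Finset.sum_mul, Finset.mul_sum]
    exact Finset.sum_congr rfl fun l _ => by ring
  rw [h2] at h1
  rw [leftMotion, contourDelta]
  linear_combination -Complex.I * h1 +
    (-(∫ x in Ioo s₀ s₁ ×ˢ Ioo s₀ s₁, hGKernel γ h U s₀ s₁ i j x * φ x) -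
      (1 : Matrix (Fin d) (Fin d) ℂ) i j * ∫ s in Ioo s₀ s₁, φ (s, s)) * Complex.I_sq

/-- The equation of motion in the second argument, in the columns outside of the fragment. -/
theorem rightMotion_eq (hZ : partitionFn U s₀ s₁ ≠ 0) (i : Fin d) {j : Fin d} (hj : p ≤ (j : ℕ))
    {φ : ℝ × ℝ → ℂ} (hφ : IsTestFunction s₀ s₁ φ) :
    rightMotion γ h U s₀ s₁ i j φ =
      (1 : Matrix (Fin d) (Fin d) ℂ) i j * contourDelta s₀ s₁ φ := by
  have h1 := hU.sum_equation_of_motion hG hZ hφ (0, 1) ((1 : Matrix (Fin d) (Fin d) ℂ) i j) i j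
    (fun l => (i, l)) (fun l x => Complex.I * deriv γ x.2 * h x.2 l j)
    (fun l => hU.memLp_weight_snd hH Complex.I (Or.inr hj))
    (fun n => hU.integral_greenTerm_mul_fderiv_snd hH n i hj hφ)
  have h2 : ∫ x in Ioo s₀ s₁ ×ˢ Ioo s₀ s₁,
      (∑ l, Complex.I * deriv γ x.2 * h x.2 l j * green U s₀ s₁ i l x.1 x.2) * φ x =
      Complex.I * ∫ x in Ioo s₀ s₁ ×ˢ Ioo s₀ s₁, GhKernel γ h U s₀ s₁ i j x * φ x := by
    rw [← integral_const_mul]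
    refine integral_congr_ae (ae_of_all _ fun x => ?_)
    simp only [GhKernel, Finset.sum_mul, Finset.mul_sum]
    exact Finset.sum_congr rfl fun l _ => by ring
  rw [h2] at h1
  rw [rightMotion, contourDelta]
  linear_combination Complex.I * h1 +
    (-(∫ x in Ioo s₀ s₁ ×ˢ Ioo s₀ s₁, GhKernel γ h U s₀ s₁ i j x * φ x) -
      (1 : Matrix (Fin d) (Fin d) ℂ) i j * ∫ s in Ioo s₀ s₁, φ (s, s)) * Complex.I_sq

end IsRegularEvolution

end

theorem theorem3p2 (σ : Statistics) (d p : ℕ) (s₀ s₁ : ℝ) (hs : s₀ < s₁)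
    (γ : ℝ → ℂ) (hγ : IsPiecewiseSmoothContour γ s₀ s₁)
    (h : ℝ → Matrix (Fin d) (Fin d) ℂ) (H : ℝ → FockOp σ d)
    (hH : IsImpurityHamiltonian p h H s₀ s₁)
    (hHcont : IsPiecewiseContinuousOp H s₀ s₁)
    (U : ℝ → ℝ → FockOp σ d) (hU : IsEvolution γ H s₀ s₁ U)
    (hTr : σ = Statistics.boson → TraceClassAssumption U s₀ s₁)
    (hG : σ = Statistics.boson → HasLocallyIntegrableTraces U s₀ s₁)
    (hZ : partitionFn U s₀ s₁ ≠ 0) :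
    -- the kernels below are locally integrable, so the distributions are well defined
    (∀ i j : Fin d, LocallyIntegrableOn (fun x : ℝ × ℝ => green U s₀ s₁ i j x.1 x.2)
      (Ioo s₀ s₁ ×ˢ Ioo s₀ s₁)) ∧
    (∀ i j : Fin d, p ≤ (i : ℕ) →
      LocallyIntegrableOn (hGKernel γ h U s₀ s₁ i j) (Ioo s₀ s₁ ×ˢ Ioo s₀ s₁)) ∧
    (∀ i j : Fin d, p ≤ (j : ℕ) →
      LocallyIntegrableOn (GhKernel γ h U s₀ s₁ i j) (Ioo s₀ s₁ ×ˢ Ioo s₀ s₁)) ∧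
    -- the sparsity of the two distributions
    (∀ i j : Fin d, p ≤ (i : ℕ) → ∀ φ, IsTestFunction s₀ s₁ φ →
      sigmaG γ h U s₀ s₁ i j φ = 0) ∧
    (∀ i j : Fin d, p ≤ (j : ℕ) → ∀ φ, IsTestFunction s₀ s₁ φ →
      gSigma γ h U s₀ s₁ i j φ = 0) ∧
    -- the non-interacting case: the equations of motion
    (p = 0 → ∀ i j : Fin d, ∀ φ, IsTestFunction s₀ s₁ φ →
      leftMotion γ h U s₀ s₁ i j φ =
        (1 : Matrix (Fin d) (Fin d) ℂ) i j * contourDelta s₀ s₁ φ ∧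
      rightMotion γ h U s₀ s₁ i j φ =
        (1 : Matrix (Fin d) (Fin d) ℂ) i j * contourDelta s₀ s₁ φ) := by
  have hR : IsRegularEvolution γ H s₀ s₁ U :=
    ⟨hU, fun s hs => (hH s hs).1, hHcont, hγ.2.2, hs⟩
  have hG' : HasLocallyIntegrableTraces U s₀ s₁ := by
    have hσ : σ = Statistics.fermion ∨ σ = Statistics.boson := by cases σ <;> simp
    exact hσ.elim hR.hasLocallyIntegrableTraces_of_fermion hG
  refine ⟨hR.locallyIntegrableOn_green hG',
    fun i j hi => hR.locallyIntegrableOn_hGKernel hG' hH j hi,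
    fun i j hj => hR.locallyIntegrableOn_GhKernel hG' hH i hj,
    fun i j hi φ hφ => ?_, fun i j hj φ hφ => ?_, fun hp i j φ hφ => ⟨?_, ?_⟩⟩
  · rw [sigmaG, hR.leftMotion_eq hG' hH hZ j hi hφ, sub_self]
  · rw [gSigma, hR.rightMotion_eq hG' hH hZ i hj hφ, sub_self]
  · exact hR.leftMotion_eq hG' hH hZ j (hp ▸ Nat.zero_le _) hφ
  · exact hR.rightMotion_eq hG' hH hZ i (hp ▸ Nat.zero_le _) hφ
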